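/- For every $n \ge 1$ let $\mathbf Y_n = (Y_{ij}^{(n)})_{i,j=1}^n$ be a random real symmetric matrix, all defined on a common probability space, such that the entries $Y_{ij}^{(n)}$, $1 \le i \le j \le n$, are independent Gaussian random variables (possibly degenerate) with $\mathbb E\, Y_{ij}^{(n)} = 0$ and $\mathbb E\, (Y_{ij}^{(n)})^2 = (\sigma_{ij}^{(n)})^2$. No relation between matrices of different sizes is assumed. Put $\big(B_i^{(n)}\big)^2 = \frac1n \sum_{j=1}^n (\sigma_{ij}^{(n)})^2$ with $B_i^{(n)} \ge 0$, and assume that 1. for every fixed $\tau > 0$, $\displaystyle \frac{1}{n^2} \sum_{i,j=1}^n \mathbb E\, |Y_{ij}^{(n)}|^2 \mathbf 1\big(|Y_{ij}^{(n)}| \ge \tau \sqrt n\big) \to 0$ as $n \to \infty$; 2. $\displaystyle \frac1n \sum_{i=1}^n \big| (B_i^{(n)})^2 - 1 \big| \to 0$ as $n \to \infty$; 3. there is a constant $C$, not depending on $n$, with $\displaystyle \max_{1 \le i \le n} B_i^{(n)} \le C$ for all $n$. Let $\lambda_1 \le \dots \le \lambda_n$ be the eigenvalues of $n^{-1/2}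 \mathbf Y_n$, counted with multiplicity, let $F^{\mathbf Y_n}(x) = \mathbb E\, \frac1n \#\{ i : \lambda_i \le x \}$ be the expected spectral distribution function, and let $G(x) = \int_{-\infty}^x \frac{1}{2\pi} \sqrt{4 - u^2}\, \mathbf 1(|u| \le 2)\, du$ be the distribution function of the standard semicircle law. Then $$ \sup_{x \in \mathbb R} \big| F^{\mathbf Y_n}(x) - G(x) \big| \to 0 \quad \text{as } n \to \infty. $$ -/

import Mathlib

open MeasureTheory ProbabilityTheory Filter Topology

noncomputable section

namespace SemicircleLaw

/-- The density of the standard semicircle law. -/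
def semicircleDensity (x : ℝ) : ℝ :=
  Set.indicator {u : ℝ | |u| ≤ 2} (fun u => 1 / (2 * Real.pi) * Real.sqrt (4 - u ^ 2)) x

/-- The distribution function of the standard semicircle law. -/
def semicircleCDF (x : ℝ) : ℝ :=
  ∫ u in Set.Iic x, semicircleDensity u

/-- The spectral distribution function of a symmetric matrix: the proportion of eigenvalues,
counted with multiplicity, that are at most `x`. -/
def spectralCDF {n : ℕ} {A : Matrix (Fin n) (Fin n) ℝ} (hA : A.IsHermitian) (x : ℝ) : ℝ :=
  ((Finset.univ.filter fun i : Fin n => hA.eigenvalues i ≤ x).card : ℝ) / n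

theorem isHermitian_normalized {n : ℕ} {A : Matrix (Fin n) (Fin n) ℝ} (hA : A.IsSymm) :
    ((Real.sqrt n)⁻¹ • A).IsHermitian := by
  unfold Matrix.IsHermitian
  rw [Matrix.conjTranspose_eq_transpose_of_trivial, Matrix.transpose_smul, hA.eq]

variable {Ω : Type*} [MeasurableSpace Ω]

/-- The expected spectral distribution function of `n^{-1/2} Y` for a random symmetric
`n × n` matrix `Y`. -/
def expectedSpectralCDF (P : Measure Ω) {n : ℕ} {Y : Ω → Matrix (Fin n) (Fin n) ℝ}
    (hY : ∀ ω, (Y ω).IsSymm) (x : ℝ) : ℝ :=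
  ∫ ω, spectralCDF (isHermitian_normalized (hY ω)) x ∂P

/-- The Lindeberg ratio of a random `n × n` matrix `Y`. -/
def lindebergRatio (P : Measure Ω) {n : ℕ} (Y : Ω → Matrix (Fin n) (Fin n) ℝ) (τ : ℝ) : ℝ :=
  1 / (n : ℝ) ^ 2 * ∑ i, ∑ j,
    ∫ ω, Set.indicator {ω' | τ * Real.sqrt n ≤ |Y ω' i j|} (fun ω' => |Y ω' i j| ^ 2) ω ∂P

/-- The normalized root-sum `B i` of the variances of row `i`, with
`(B i) ^ 2 = (1 / n) * ∑ j, (σ i j) ^ 2`. -/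
def rowB {n : ℕ} (σ : Fin n → Fin n → ℝ) (i : Fin n) : ℝ :=
  Real.sqrt (1 / (n : ℝ) * ∑ j, σ i j ^ 2)

end SemicircleLaw

end

/-! The proof is the Stieltjes transform method, run on a single horizontal line Im z = η with η
large compared with `C`. Let G be the resolvent of A = n^{-1/2} Y at z, and let m be the Stieltjes
transform of the semicircle law, which solves m(-z - m) = 1. The Schur complement formula writes
1/G_ii as A_ii - z minus a quadratic form in row i, whose coefficients R form the resolvent of the
i-th minor and are independent of that row. Gaussian fourth moments put this form close in L² to ∑_j
s_ij R_jj, with s_ij the variances of the entries of A, and the Ward identity allows R_jj to be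
replaced by G_jj. Comparison with the equation for m bounds E|G_ii - m| by η^{-2} (∑_j s_ij E|G_jj -
m| + errors). After summation over i the first term is at most half of the left side, because ∑_j
s_ij ≤ C² ≤ η²/2, and is absorbed (`sum_integral_norm_matrixResolvent_sub_le`).

The errors involve max_j s_ij and |∑_j s_ij - 1|, and need to be small only on average over i. The
second is the row-sum hypothesis; the first is at most τ² plus the Lindeberg contribution of row i
(`sq_le_add_sum_indicator`).

One line suffices because Im of a Stieltjes transform at height η is π times the density of the
convolution with a Cauchy law. Pointwise convergence of these densities gives, by Scheffé's lemma,
convergence of their Fourier transforms, and the transform of the Cauchy law never vanishes, so it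
can be divided out (`tendsto_of_tendsto_stieltjes`). The semicircle law has no atoms, so weak
convergence becomes uniform convergence of distribution functions
(`eventually_abs_sub_le_of_tendsto`). -/

namespace SemicircleLaw

open scoped Matrix NNReal

/-! ### Resolvents of real symmetric matrices, their minors, and the Schur complement. -/

section Resolvent

variable {ι : Type*} [Fintype ι] [DecidableEq ι]

/-- The resolvent `(A - z)⁻¹` of a real matrix at a complex point. -/
noncomputable def matrixResolvent (A : Matrix ι ι ℝ) (z : ℂ) : Matrix ι ι ℂ :=
  (A.map (fun x : ℝ => (x : ℂ)) - z • (1 : Matrix ι ι ℂ))⁻¹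

theorem matrixResolvent_spectral {A : Matrix ι ι ℝ} (hA : A.IsHermitian) {z : ℂ} (hz : z.im ≠ 0) :
    ∃ U V : Matrix ι ι ℂ, V * U = 1 ∧ U * V = 1 ∧
      A.map (fun x : ℝ => (x : ℂ)) - z • (1 : Matrix ι ι ℂ)
        = U * Matrix.diagonal (fun i => (hA.eigenvalues i : ℂ) - z) * V ∧
      matrixResolvent A z
        = U * Matrix.diagonal (fun i => ((hA.eigenvalues i : ℂ) - z)⁻¹) * V := by
  have hsp := hA.spectral_theorem
  rw [Unitary.conjStarAlgAut_apply] at hsp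
  set W : Matrix ι ι ℝ := (hA.eigenvectorUnitary : Matrix ι ι ℝ) with hW
  have h1 : W * star W = 1 := Unitary.mul_star_self_of_mem hA.eigenvectorUnitary.2
  have h2 : star W * W = 1 := Unitary.star_mul_self_of_mem hA.eigenvectorUnitary.2
  let φ : Matrix ι ι ℝ →+* Matrix ι ι ℂ := Complex.ofRealHom.mapMatrix
  have hφ : ∀ B : Matrix ι ι ℝ, φ B = B.map (fun x : ℝ => (x : ℂ)) := fun B => rfl
  have h1' : φ W * φ (star W) = 1 := by rw [← map_mul, h1, map_one]
  have h2' : φ (star W) * φ W = 1 := by rw [← map_mul, h2, map_one]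
  have hne : ∀ i, (hA.eigenvalues i : ℂ) - z ≠ 0 := by
    intro i h
    apply hz
    have := congrArg Complex.im h
    simpa using this
  have key : A.map (fun x : ℝ => (x : ℂ)) - z • (1 : Matrix ι ι ℂ)
        = φ W * Matrix.diagonal (fun i => (hA.eigenvalues i : ℂ) - z) * φ (star W) := by
    have e1 : A.map (fun x : ℝ => (x : ℂ))
        = φ W * Matrix.diagonal (fun i => (hA.eigenvalues i : ℂ)) * φ (star W) := by
      refine (congrArg φ hsp).trans ?_
      rw [map_mul, map_mul]
      congr 2
      ext i j
      simp [hφ, Matrix.diagonal_apply]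
      split_ifs <;> simp
    have e2 : (Matrix.diagonal (fun i => (hA.eigenvalues i : ℂ) - z))
        = Matrix.diagonal (fun i => (hA.eigenvalues i : ℂ)) - z • (1 : Matrix ι ι ℂ) := by
      ext i j
      by_cases hij : i = j
      · subst hij; simp
      · simp [hij]
    rw [e1, e2, mul_sub, sub_mul]
    congr 1
    rw [mul_smul_comm, smul_mul_assoc, mul_one, h1']
  refine ⟨φ W, φ (star W), h2', h1', key, ?_⟩
  unfold matrixResolvent
  apply Matrix.inv_eq_right_inv
  rw [key]
  calc φ W * Matrix.diagonal (fun i => (hA.eigenvalues i : ℂ) - z) * φ (star W)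
        * (φ W * Matrix.diagonal (fun i => ((hA.eigenvalues i : ℂ) - z)⁻¹) * φ (star W))
      = φ W * (Matrix.diagonal (fun i => (hA.eigenvalues i : ℂ) - z) * (φ (star W)
        * φ W) * Matrix.diagonal (fun i => ((hA.eigenvalues i : ℂ) - z)⁻¹)) * φ (star W) := by
          simp only [mul_assoc]
    _ = 1 := by
      rw [h2', mul_one, Matrix.diagonal_mul_diagonal]
      simp only [mul_inv_cancel₀ (hne _)]
      rw [Matrix.diagonal_one, mul_one, h1']

theorem trace_matrixResolvent {A : Matrix ι ι ℝ} (hA : A.IsHermitian) {z : ℂ} (hz : z.im ≠ 0) :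
    ∑ i, matrixResolvent A z i i = ∑ i, ((hA.eigenvalues i : ℂ) - z)⁻¹ := by
  obtain ⟨U, V, hVU, -, -, hG⟩ := matrixResolvent_spectral hA hz
  change (matrixResolvent A z).trace = _
  rw [hG, Matrix.trace_mul_comm, ← mul_assoc, hVU, one_mul, Matrix.trace_diagonal]

theorem matrixResolvent_mul_self {A : Matrix ι ι ℝ} (hA : A.IsHermitian) {z : ℂ} (hz : z.im ≠ 0) :
    (A.map (fun x : ℝ => (x : ℂ)) - z • (1 : Matrix ι ι ℂ)) * matrixResolvent A z = 1 ∧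
    matrixResolvent A z * (A.map (fun x : ℝ => (x : ℂ)) - z • (1 : Matrix ι ι ℂ)) = 1 := by
  obtain ⟨U, V, hVU, hUV, hB, hG⟩ := matrixResolvent_spectral hA hz
  have hne : ∀ i, (hA.eigenvalues i : ℂ) - z ≠ 0 := by
    intro i h
    apply hz
    have := congrArg Complex.im h
    simpa using this
  have h : (A.map (fun x : ℝ => (x : ℂ)) - z • (1 : Matrix ι ι ℂ)) * matrixResolvent A z = 1 := by
    rw [hB, hG]
    calc U * Matrix.diagonal (fun i => (hA.eigenvalues i : ℂ) - z) * V
        * (U * Matrix.diagonal (fun i => ((hA.eigenvalues i : ℂ) - z)⁻¹) * V)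
      = U * (Matrix.diagonal (fun i => (hA.eigenvalues i : ℂ) - z) * (V
        * U) * Matrix.diagonal (fun i => ((hA.eigenvalues i : ℂ) - z)⁻¹)) * V := by
          simp only [mul_assoc]
    _ = 1 := by
      rw [hVU, mul_one, Matrix.diagonal_mul_diagonal]
      simp only [mul_inv_cancel₀ (hne _)]
      rw [Matrix.diagonal_one, mul_one, hUV]
  exact ⟨h, mul_eq_one_comm.mp h⟩

theorem matrixResolvent_symm {A : Matrix ι ι ℝ} (hA : A.IsHermitian) (z : ℂ) (i j : ι) :
    matrixResolvent A z i j = matrixResolvent A z j i := by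
  have : (matrixResolvent A z)ᵀ = matrixResolvent A z := by
    unfold matrixResolvent
    rw [Matrix.transpose_nonsing_inv]
    congr 1
    rw [Matrix.transpose_sub, Matrix.transpose_smul, Matrix.transpose_one, ← Matrix.transpose_map]
    rw [Matrix.IsHermitian, Matrix.conjTranspose_eq_transpose_of_trivial] at hA
    rw [hA]
  conv_rhs => rw [← this]
  rfl

/-- The Ward identity: the diagonal of G - G* = (z - z̄) G G*, which follows from the resolvent
equations for z and z̄. -/
theorem matrixResolvent_ward {A : Matrix ι ι ℝ} (hA : A.IsHermitian) {z : ℂ} (hz : z.im ≠ 0)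
    (i : ι) : (matrixResolvent A z i i).im = z.im * ∑ j, ‖matrixResolvent A z i j‖ ^ 2 := by
  obtain ⟨h1, h2⟩ := matrixResolvent_mul_self hA hz
  set G := matrixResolvent A z with hG
  set B := A.map (fun x : ℝ => (x : ℂ)) with hB
  have hBH : B.conjTranspose = B := by
    ext a b
    have := congrFun (congrFun hA a) b
    simp only [Matrix.conjTranspose_apply, star_trivial] at this
    simp [hB, Matrix.conjTranspose_apply, this]
  have h3 : (B - star z • (1 : Matrix ι ι ℂ)) * G.conjTranspose = 1 := by
    have := congrArg Matrix.conjTranspose h2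
    rw [Matrix.conjTranspose_mul, Matrix.conjTranspose_sub, hBH, Matrix.conjTranspose_smul,
      Matrix.conjTranspose_one] at this
    exact this
  have key : G - G.conjTranspose = (z - star z) • (G * G.conjTranspose) := by
    calc G - G.conjTranspose
        = G * ((B - star z • (1 : Matrix ι ι ℂ)) * G.conjTranspose)
          - (G * (B - z • (1 : Matrix ι ι ℂ))) * G.conjTranspose := by
            rw [h3, h2, mul_one, one_mul]
      _ = (z - star z) • (G * G.conjTranspose) := by
            rw [mul_assoc, ← mul_sub, ← sub_mul, sub_sub_sub_cancel_left, ← sub_smul,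
              smul_mul_assoc, one_mul, mul_smul_comm]
  have e := congrArg Complex.im (congrFun (congrFun key i) i)
  have e2 : (G * G.conjTranspose) i i = ((∑ j, ‖G i j‖ ^ 2 : ℝ) : ℂ) := by
    rw [Matrix.mul_apply]
    push_cast
    refine Finset.sum_congr rfl fun j _ => ?_
    rw [Matrix.conjTranspose_apply]
    simpa using Complex.mul_conj' (G i j)
  rw [Matrix.smul_apply, e2] at e
  simp only [Matrix.sub_apply, Matrix.conjTranspose_apply, Complex.sub_im, smul_eq_mul,
    Complex.im_mul_ofReal] at e
  have c1 : (star (G i i)).im = -(G i i).im := Complex.conj_im _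
  have c2 : (star z).im = -z.im := Complex.conj_im _
  rw [c1, c2] at e
  linarith

theorem sum_norm_sq_matrixResolvent_le {A : Matrix ι ι ℝ} (hA : A.IsHermitian) {z : ℂ}
    (hz : 0 < z.im) (i : ι) :
    ∑ j, ‖matrixResolvent A z i j‖ ^ 2 ≤ ‖matrixResolvent A z i i‖ / z.im := by
  rw [le_div_iff₀ hz, mul_comm, ← matrixResolvent_ward hA hz.ne']
  exact (le_abs_self _).trans (Complex.abs_im_le_norm _)

/-- No operator norm is needed: |G_ii|² is one term of the Ward sum, which is at most |G_ii| / Im z.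
-/
theorem norm_matrixResolvent_diag_le {A : Matrix ι ι ℝ} (hA : A.IsHermitian) {z : ℂ}
    (hz : 0 < z.im) (i : ι) : ‖matrixResolvent A z i i‖ ≤ 1 / z.im := by
  have h := sum_norm_sq_matrixResolvent_le hA hz i
  have h2 : ‖matrixResolvent A z i i‖ ^ 2 ≤ ∑ j, ‖matrixResolvent A z i j‖ ^ 2 :=
    Finset.single_le_sum (f := fun j => ‖matrixResolvent A z i j‖ ^ 2)
      (fun _ _ => by positivity) (Finset.mem_univ i)
  rcases (norm_nonneg (matrixResolvent A z i i)).eq_or_lt with h0 | h0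
  · rw [← h0]; positivity
  · have h3 := h2.trans h
    rw [pow_two, div_eq_mul_one_div] at h3
    exact le_of_mul_le_mul_left h3 h0

theorem sum_norm_sq_matrixResolvent_le' {A : Matrix ι ι ℝ} (hA : A.IsHermitian) {z : ℂ}
    (hz : 0 < z.im) (i : ι) :
    ∑ j, ‖matrixResolvent A z i j‖ ^ 2 ≤ 1 / z.im ^ 2 := by
  refine (sum_norm_sq_matrixResolvent_le hA hz i).trans ?_
  rw [div_le_div_iff₀ hz (by positivity)]
  have := norm_matrixResolvent_diag_le hA hz i
  rw [le_div_iff₀ hz] at this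
  nlinarith

theorem norm_matrixResolvent_le {A : Matrix ι ι ℝ} (hA : A.IsHermitian) {z : ℂ}
    (hz : 0 < z.im) (i j : ι) : ‖matrixResolvent A z i j‖ ≤ 1 / z.im := by
  have h := sum_norm_sq_matrixResolvent_le' hA hz i
  have h2 : ‖matrixResolvent A z i j‖ ^ 2 ≤ ∑ j, ‖matrixResolvent A z i j‖ ^ 2 :=
    Finset.single_le_sum (f := fun j => ‖matrixResolvent A z i j‖ ^ 2)
      (fun _ _ => by positivity) (Finset.mem_univ j)
  refine le_of_sq_le_sq ?_ (by positivity)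
  rw [div_pow, one_pow]
  exact h2.trans h

/-- The matrix `A` with row and column `i` replaced by zero. -/
def zeroCross {R : Type*} [Zero R] (A : Matrix ι ι R) (i : ι) : Matrix ι ι R :=
  Matrix.of fun j k => if j = i ∨ k = i then 0 else A j k

theorem zeroCross_isHermitian {κ : Type*} [DecidableEq κ] {A : Matrix κ κ ℝ}
    (hA : A.IsHermitian) (i : κ) :
    (zeroCross A i).IsHermitian := by
  ext j k
  have := congrFun (congrFun hA j) k
  simp only [Matrix.conjTranspose_apply, star_trivial] at this
  simp [zeroCross, Matrix.conjTranspose_apply, this, or_comm]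

/-- The resolvent of the minor of `A` obtained by deleting index `i`, extended by zero. -/
noncomputable def minorResolvent (A : Matrix ι ι ℝ) (z : ℂ) (i : ι) : Matrix ι ι ℂ :=
  zeroCross (matrixResolvent (zeroCross A i) z) i

/-- Row i of the matrix with zeroed cross, minus z, is -z times a unit vector. Keeping the full
index set and zeroing the cross thus decouples i, so minors never require a change of index type. -/
theorem matrixResolvent_zeroCross_row {A : Matrix ι ι ℝ} (hA : A.IsHermitian) {z : ℂ}
    (hz : z.im ≠ 0) {i k : ι} (hk : k ≠ i) : matrixResolvent (zeroCross A i) z i k = 0 := by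
  have h := (matrixResolvent_mul_self (zeroCross_isHermitian hA i) hz).1
  have hz0 : z ≠ 0 := by rintro rfl; simp at hz
  have e := congrFun (congrFun h i) k
  rw [sub_mul, smul_mul_assoc, one_mul, Matrix.one_apply_ne hk.symm, Matrix.sub_apply,
    Matrix.smul_apply, Matrix.mul_apply] at e
  simpa [zeroCross, hz0] using e

theorem minorResolvent_apply_of_ne {A : Matrix ι ι ℝ} (hA : A.IsHermitian) {z : ℂ}
    (hz : z.im ≠ 0) {i j : ι} (hj : j ≠ i) (k : ι) :
    minorResolvent A z i j k = matrixResolvent (zeroCross A i) z j k := by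
  unfold minorResolvent
  by_cases hk : k = i
  · subst hk
    rw [matrixResolvent_symm (zeroCross_isHermitian hA k),
      matrixResolvent_zeroCross_row hA hz hj]
    simp [zeroCross]
  · simp [zeroCross, hj, hk]

theorem minorResolvent_symm {A : Matrix ι ι ℝ} (hA : A.IsHermitian) (z : ℂ) (i j k : ι) :
    minorResolvent A z i j k = minorResolvent A z i k j := by
  unfold minorResolvent
  have := matrixResolvent_symm (zeroCross_isHermitian hA i) z j k
  simp [zeroCross, or_comm] at this ⊢
  simp [this]

theorem minorResolvent_row (A : Matrix ι ι ℝ) (z : ℂ) (i k : ι) :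
    minorResolvent A z i i k = 0 := by simp [minorResolvent, zeroCross]

theorem norm_minorResolvent_le_norm (A : Matrix ι ι ℝ) (z : ℂ) (i j k : ι) :
    ‖minorResolvent A z i j k‖ ≤ ‖matrixResolvent (zeroCross A i) z j k‖ := by
  change ‖if j = i ∨ k = i then 0 else matrixResolvent (zeroCross A i) z j k‖ ≤ _
  split_ifs <;> simp

theorem norm_minorResolvent_le {A : Matrix ι ι ℝ} (hA : A.IsHermitian) {z : ℂ}
    (hz : 0 < z.im) (i j k : ι) : ‖minorResolvent A z i j k‖ ≤ 1 / z.im :=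
  (norm_minorResolvent_le_norm A z i j k).trans
    (norm_matrixResolvent_le (zeroCross_isHermitian hA i) hz j k)

theorem sum_norm_sq_minorResolvent_le {A : Matrix ι ι ℝ} (hA : A.IsHermitian) {z : ℂ}
    (hz : 0 < z.im) (i j : ι) :
    ∑ k, ‖minorResolvent A z i j k‖ ^ 2 ≤ 1 / z.im ^ 2 := by
  refine le_trans (Finset.sum_le_sum fun k _ => ?_)
    (sum_norm_sq_matrixResolvent_le' (zeroCross_isHermitian hA i) hz j)
  have := norm_minorResolvent_le_norm A z i j k
  gcongr

/-- The resolvent identity obtained by inserting R(H - z) = 1 before G, where H is A with cross i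
zeroed. For j ≠ i, row j of H differs from row j of A only in column i, which produces the single
correction term. -/
theorem matrixResolvent_eq_minorResolvent_sub {A : Matrix ι ι ℝ} (hA : A.IsHermitian) {z : ℂ}
    (hz : z.im ≠ 0) {i a : ι} (ha : a ≠ i) (k : ι) :
    matrixResolvent A z a k = minorResolvent A z i a k
      - matrixResolvent A z i k * ∑ j, minorResolvent A z i a j * A i j := by
  set G := matrixResolvent A z with hG
  set H := zeroCross A i with hH
  set R := matrixResolvent H z with hR
  have h1 := (matrixResolvent_mul_self (zeroCross_isHermitian hA i) hz).2
  have h2 := (matrixResolvent_mul_self hA hz).1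
  have hE : G a k
      = ∑ j, R a j * ((H.map (fun x : ℝ => (x : ℂ)) - z • (1 : Matrix ι ι ℂ)) * G) j k := by
    rw [← Matrix.mul_apply, ← mul_assoc, h1, one_mul]
  have hsymm : ∀ j k, A j k = A k j := fun j k => by
    have := congrFun (congrFun hA k) j
    simpa using this
  rw [hE, Finset.mul_sum]
  have hdelta : minorResolvent A z i a k
      = ∑ j, minorResolvent A z i a j * (1 : Matrix ι ι ℂ) j k := by
    rw [← Matrix.mul_apply, mul_one]
  rw [hdelta, ← Finset.sum_sub_distrib]
  refine Finset.sum_congr rfl fun j _ => ?_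
  rw [minorResolvent_apply_of_ne hA hz ha]
  by_cases hj : j = i
  · subst hj
    rw [matrixResolvent_symm (zeroCross_isHermitian hA j),
      matrixResolvent_zeroCross_row hA hz ha]
    have hR0 : R a j = 0 := by
      rw [hR, matrixResolvent_symm (zeroCross_isHermitian hA j),
        matrixResolvent_zeroCross_row hA hz ha]
    simp [hR0]
  · have hd : (1 : Matrix ι ι ℂ) j k
        = ((A.map (fun x : ℝ => (x : ℂ)) - z • (1 : Matrix ι ι ℂ)) * G) j k := by rw [h2]
    rw [hd]
    have : (H.map (fun x : ℝ => (x : ℂ)) * G) j k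
        = (A.map (fun x : ℝ => (x : ℂ)) * G) j k - A i j * G i k := by
      rw [Matrix.mul_apply, Matrix.mul_apply, eq_sub_iff_add_eq,
        ← Finset.add_sum_erase _ _ (Finset.mem_univ i),
        ← Finset.add_sum_erase (a := i) _ (fun l => A.map (fun x : ℝ => (x : ℂ)) j l * G l k)
          (Finset.mem_univ i)]
      have : ∑ l ∈ Finset.univ.erase i, H.map (fun x : ℝ => (x : ℂ)) j l * G l k
          = ∑ l ∈ Finset.univ.erase i, A.map (fun x : ℝ => (x : ℂ)) j l * G l k := by
        refine Finset.sum_congr rfl fun l hl => ?_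
        have hl' : l ≠ i := Finset.ne_of_mem_erase hl
        simp [hH, zeroCross, hj, hl']
      rw [this]
      simp [hH, zeroCross, hsymm i j]
    rw [sub_mul, sub_mul, Matrix.sub_apply, Matrix.sub_apply, this, hR, hH]
    ring

/-- The Schur complement formula for a diagonal entry of the resolvent. -/
theorem matrixResolvent_diag_mul {A : Matrix ι ι ℝ} (hA : A.IsHermitian) {z : ℂ}
    (hz : z.im ≠ 0) (i : ι) :
    matrixResolvent A z i i * (A i i - z
      - ∑ j, ∑ k, (A i j : ℂ) * A i k * minorResolvent A z i j k) = 1 := by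
  have h2 := (matrixResolvent_mul_self hA hz).1
  have e := congrFun (congrFun h2 i) i
  rw [sub_mul, smul_mul_assoc, one_mul, Matrix.one_apply_eq, Matrix.sub_apply,
    Matrix.smul_apply, Matrix.mul_apply, ← Finset.add_sum_erase _ _ (Finset.mem_univ i)] at e
  have hs : ∑ l ∈ Finset.univ.erase i, A.map (fun x : ℝ => (x : ℂ)) i l * matrixResolvent A z l i
      = - (matrixResolvent A z i i
        * ∑ j, ∑ k, (A i j : ℂ) * A i k * minorResolvent A z i j k) := by
    rw [← Finset.add_sum_erase _ (fun j => ∑ k, (A i j : ℂ) * A i k * minorResolvent A z i j k)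
      (Finset.mem_univ i)]
    simp only [minorResolvent_row, mul_zero, Finset.sum_const_zero, zero_add]
    rw [Finset.mul_sum, ← Finset.sum_neg_distrib]
    refine Finset.sum_congr rfl fun l hl => ?_
    have hl' : l ≠ i := Finset.ne_of_mem_erase hl
    rw [matrixResolvent_eq_minorResolvent_sub hA hz hl', minorResolvent_symm hA,
      minorResolvent_row, zero_sub, Matrix.map_apply, mul_neg, Finset.mul_sum, Finset.mul_sum,
      Finset.mul_sum]
    congr 1
    refine Finset.sum_congr rfl fun k _ => ?_
    ring
  rw [hs, Matrix.map_apply, smul_eq_mul] at e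
  rw [← e]
  ring

/-- For j ≠ i the rank-one formula R_jj - G_jj = -G_ij² / G_ii gives equality. The numerators are
summable over j by the Ward identity. -/
theorem norm_minorResolvent_sub_le {A : Matrix ι ι ℝ} (hA : A.IsHermitian) {z : ℂ}
    (hz : z.im ≠ 0) (i j : ι) :
    ‖minorResolvent A z i j j - matrixResolvent A z j j‖
      ≤ ‖matrixResolvent A z i j‖ ^ 2 / ‖matrixResolvent A z i i‖ := by
  have h0 : matrixResolvent A z i i ≠ 0 :=
    left_ne_zero_of_mul_eq_one (matrixResolvent_diag_mul hA hz i)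
  have h0' : 0 < ‖matrixResolvent A z i i‖ := norm_pos_iff.mpr h0
  by_cases hj : j = i
  · subst hj
    rw [minorResolvent_row, zero_sub, norm_neg, le_div_iff₀ h0', pow_two]
  · rw [le_div_iff₀ h0', ← norm_mul, ← norm_pow]
    have h1 := matrixResolvent_eq_minorResolvent_sub hA hz hj i
    have h2 := matrixResolvent_eq_minorResolvent_sub hA hz hj j
    rw [minorResolvent_symm hA, minorResolvent_row, zero_sub, matrixResolvent_symm hA] at h1
    have : (minorResolvent A z i j j - matrixResolvent A z j j) * matrixResolvent A z i i
        = - matrixResolvent A z i j ^ 2 := by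
      rw [h2]
      linear_combination (matrixResolvent A z i j) * h1
    rw [this, norm_neg]

/-- Deterministic self-consistency estimate for a diagonal entry of the resolvent. -/
theorem norm_matrixResolvent_diag_sub_le {A : Matrix ι ι ℝ} (hA : A.IsHermitian) {z m : ℂ}
    (hz : 0 < z.im) (hm : m * (-z - m) = 1) (hmb : ‖m‖ ≤ 1 / z.im) (i : ι) {s : ι → ℝ} {M : ℝ}
    (hs : ∀ j, 0 ≤ s j) (hsM : ∀ j, s j ≤ M) :
    ‖matrixResolvent A z i i - m‖ ≤ (1 / z.im ^ 2) * (|A i i|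
      + ‖∑ j, ∑ k, (A i j : ℂ) * A i k * minorResolvent A z i j k
          - ∑ j, (s j : ℂ) * minorResolvent A z i j j‖
      + M / z.im + ∑ j, s j * ‖matrixResolvent A z j j - m‖ + |∑ j, s j - 1| / z.im) := by
  set S := ∑ j, ∑ k, (A i j : ℂ) * A i k * minorResolvent A z i j k with hS
  set G := matrixResolvent A z with hG
  set R := minorResolvent A z i with hR
  have hsch : G i i * (A i i - z - S) = 1 := matrixResolvent_diag_mul hA hz.ne' i
  have hG0 : 0 < ‖G i i‖ := norm_pos_iff.mpr (left_ne_zero_of_mul_eq_one hsch)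
  -- This is G - m = G m (1/m - 1/G), with both reciprocals read off from their equations.
  have e1 : G i i - m = G i i * m * (S - m - A i i) := by
    linear_combination (-G i i) * hm + m * hsch
  -- The error splits into the diagonal entry, the fluctuation of the quadratic form, the passage
  -- from minor to full resolvent, the self-consistent term, and the defect of the row sum from 1.
  have e2 : S - m - A i i = - (A i i : ℂ) + (S - ∑ j, (s j : ℂ) * R j j)
      + ∑ j, (s j : ℂ) * (R j j - G j j) + ∑ j, (s j : ℂ) * (G j j - m)
      + m * ((∑ j, s j - 1 : ℝ) : ℂ) := by
    simp only [mul_sub, Finset.sum_sub_distrib]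
    push_cast
    rw [← Finset.sum_mul]
    ring
  have b1 : ‖∑ j, (s j : ℂ) * (R j j - G j j)‖ ≤ M / z.im := by
    have hM : 0 ≤ M := (hs i).trans (hsM i)
    calc ‖∑ j, (s j : ℂ) * (R j j - G j j)‖
        ≤ ∑ j, M * (‖G i j‖ ^ 2 / ‖G i i‖) := by
          refine norm_sum_le_of_le _ fun j _ => ?_
          rw [norm_mul, Complex.norm_real, Real.norm_of_nonneg (hs j)]
          exact mul_le_mul (hsM j) (norm_minorResolvent_sub_le hA hz.ne' i j) (norm_nonneg _) hM
      _ = M * ((∑ j, ‖G i j‖ ^ 2) / ‖G i i‖) := by rw [← Finset.mul_sum, Finset.sum_div]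
      -- The Ward bound on ∑_j |G_ij|² carries a factor |G_ii| that cancels the denominator, so no
      -- lower bound on |G_ii| is needed.
      _ ≤ M * (1 / z.im) := by
          refine mul_le_mul_of_nonneg_left ?_ hM
          rw [div_le_iff₀ hG0]
          refine (sum_norm_sq_matrixResolvent_le hA hz i).trans (le_of_eq ?_)
          ring
      _ = M / z.im := by ring
  have b2 : ‖∑ j, (s j : ℂ) * (G j j - m)‖ ≤ ∑ j, s j * ‖G j j - m‖ := by
    refine norm_sum_le_of_le _ fun j _ => ?_
    rw [norm_mul, Complex.norm_real, Real.norm_of_nonneg (hs j)]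
  have b3 : ‖m * ((∑ j, s j - 1 : ℝ) : ℂ)‖ ≤ |∑ j, s j - 1| / z.im := by
    rw [norm_mul, Complex.norm_real, Real.norm_eq_abs]
    calc _ ≤ 1 / z.im * |∑ j, s j - 1| := by gcongr
      _ = _ := by ring
  have b0 : ‖-(A i i : ℂ)‖ = |A i i| := by rw [norm_neg, Complex.norm_real, Real.norm_eq_abs]
  rw [e1, norm_mul, norm_mul]
  have hGb : ‖G i i‖ ≤ 1 / z.im := norm_matrixResolvent_diag_le hA hz i
  have : ‖S - m - A i i‖ ≤ |A i i| + ‖S - ∑ j, (s j : ℂ) * R j j‖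
      + M / z.im + ∑ j, s j * ‖G j j - m‖ + |∑ j, s j - 1| / z.im := by
    rw [e2]
    refine (norm_add_le _ _).trans (add_le_add ?_ b3)
    refine (norm_add_le _ _).trans (add_le_add ?_ b2)
    refine (norm_add_le _ _).trans (add_le_add ?_ b1)
    refine (norm_add_le _ _).trans (add_le_add b0.le le_rfl)
  have h3 : ‖G i i‖ * ‖m‖ ≤ 1 / z.im ^ 2 := by
    calc _ ≤ 1 / z.im * (1 / z.im) := by gcongr
      _ = _ := by rw [pow_two]; field_simp
  exact mul_le_mul h3 this (norm_nonneg _) (by positivity)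

end Resolvent

/-! ### Moments of the centred Gaussian law. -/

theorem hasDerivAt_mul_exp_sq (v : ℝ) {p p' : ℝ → ℝ} {t : ℝ} (hp : HasDerivAt p (p' t) t) :
    HasDerivAt (fun t => p t * Real.exp (v * t ^ 2 / 2))
      ((p' t + v * t * p t) * Real.exp (v * t ^ 2 / 2)) t := by
  have h : HasDerivAt (fun t : ℝ => Real.exp (v * t ^ 2 / 2))
      (Real.exp (v * t ^ 2 / 2) * (v * t)) t := by
    apply HasDerivAt.exp
    have := ((hasDerivAt_pow 2 t).const_mul v).div_const 2
    convert! this using 1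
    simp
    ring
  convert! hp.mul h using 1
  ring

/-- The moments are derivatives at 0 of the moment generating function exp(v t²/2); each derivative
is again a polynomial times this exponential. -/
theorem gaussianReal_moments (v : ℝ≥0) :
    ∫ x, x ∂gaussianReal 0 v = 0 ∧ ∫ x, x ^ 2 ∂gaussianReal 0 v = v ∧
      ∫ x, x ^ 4 ∂gaussianReal 0 v = 3 * (v : ℝ) ^ 2 := by
  have h0 : (0 : ℝ) ∈ interior (integrableExpSet (fun x : ℝ => x) (gaussianReal 0 v)) := by
    rw [integrableExpSet_fun_id_gaussianReal]; simp
  have hm : mgf (fun x : ℝ => x) (gaussianReal 0 v) = fun t => Real.exp (v * t ^ 2 / 2) := by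
    rw [mgf_fun_id_gaussianReal]; simp
  have e1 : deriv (fun t : ℝ => Real.exp (v * t ^ 2 / 2))
      = fun t => ((v : ℝ) * t) * Real.exp (v * t ^ 2 / 2) := by
    funext t
    have := hasDerivAt_mul_exp_sq v (p := fun _ => 1) (p' := fun _ => 0) (hasDerivAt_const t 1)
    simpa using this.deriv
  have e2 : deriv (fun t : ℝ => ((v : ℝ) * t) * Real.exp (v * t ^ 2 / 2))
      = fun t => ((v : ℝ) + v ^ 2 * t ^ 2) * Real.exp (v * t ^ 2 / 2) := by
    funext t
    have hp : HasDerivAt (fun t : ℝ => (v : ℝ) * t) v t := by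
      simpa using (hasDerivAt_id t).const_mul (v : ℝ)
    rw [(hasDerivAt_mul_exp_sq v (p' := fun _ => (v : ℝ)) hp).deriv]
    ring
  have e3 : deriv (fun t : ℝ => ((v : ℝ) + v ^ 2 * t ^ 2) * Real.exp (v * t ^ 2 / 2))
      = fun t => (3 * (v : ℝ) ^ 2 * t + v ^ 3 * t ^ 3) * Real.exp (v * t ^ 2 / 2) := by
    funext t
    have hp : HasDerivAt (fun t : ℝ => (v : ℝ) + v ^ 2 * t ^ 2) (v ^ 2 * (2 * t)) t := by
      simpa using ((hasDerivAt_pow 2 t).const_mul ((v : ℝ) ^ 2)).const_add (v : ℝ)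
    rw [(hasDerivAt_mul_exp_sq v (p' := fun t => (v : ℝ) ^ 2 * (2 * t)) hp).deriv]
    ring
  have e4 : deriv (fun t : ℝ => (3 * (v : ℝ) ^ 2 * t + v ^ 3 * t ^ 3) * Real.exp (v * t ^ 2 / 2)) 0
      = 3 * (v : ℝ) ^ 2 := by
    have hp : HasDerivAt (fun t : ℝ => 3 * (v : ℝ) ^ 2 * t + v ^ 3 * t ^ 3)
        (3 * (v : ℝ) ^ 2 * 1 + v ^ 3 * (3 * (0 : ℝ) ^ 2)) 0 := by
      convert! ((hasDerivAt_id (0 : ℝ)).const_mul (3 * (v : ℝ) ^ 2)).add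
        ((hasDerivAt_pow 3 (0 : ℝ)).const_mul ((v : ℝ) ^ 3)) using 1
    rw [(hasDerivAt_mul_exp_sq v
      (p' := fun t => 3 * (v : ℝ) ^ 2 * 1 + v ^ 3 * (3 * t ^ 2)) hp).deriv]
    simp
  refine ⟨integral_id_gaussianReal, ?_, ?_⟩
  · have h := iteratedDeriv_mgf_zero h0 2
    rw [hm] at h
    simp only [Pi.pow_apply] at h
    rw [← h, iteratedDeriv_succ, iteratedDeriv_one, e1, e2]
    simp
  · have h := iteratedDeriv_mgf_zero h0 4
    rw [hm] at h
    simp only [Pi.pow_apply] at h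
    rw [← h, iteratedDeriv_succ, iteratedDeriv_succ, iteratedDeriv_succ, iteratedDeriv_one, e1, e2,
      e3, e4]

/-! ### Fourth moments and quadratic forms of independent Gaussian variables. -/

section Wick

variable {Ω : Type*} [MeasurableSpace Ω] {P : Measure Ω} {ι : Type*}

theorem integral_comp_of_hasLaw_gaussian {X : Ω → ℝ} {v : ℝ≥0}
    (hX : HasLaw X (gaussianReal 0 v) P) :
    ∫ ω, X ω ∂P = 0 ∧ ∫ ω, X ω ^ 2 ∂P = v ∧ ∫ ω, X ω ^ 4 ∂P = 3 * (v : ℝ) ^ 2 := by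
  obtain ⟨h1, h2, h4⟩ := gaussianReal_moments v
  refine ⟨?_, ?_, ?_⟩
  · rw [← h1]; exact hX.integral_comp (f := fun x => x) (by fun_prop)
  · rw [← h2]; exact hX.integral_comp (f := fun x => x ^ 2) (by fun_prop)
  · rw [← h4]; exact hX.integral_comp (f := fun x => x ^ 4) (by fun_prop)

theorem memLp_of_hasLaw_gaussian {X : Ω → ℝ} {v : ℝ≥0}
    (hX : HasLaw X (gaussianReal 0 v) P) (p : ℝ≥0) : MemLp X p P := by
  have := memLp_id_gaussianReal (μ := 0) (v := v) p
  rw [← hX.map_eq] at this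
  exact this.comp_of_map hX.aemeasurable

/-- A factor whose index occurs once is independent of the rest and has mean zero; b, c, d may
coincide among themselves. -/
theorem integral_mul_eq_zero_of_notMem {x : ι → Ω → ℝ} (hx : iIndepFun x P) {v : ι → ℝ≥0}
    (hlaw : ∀ i, HasLaw (x i) (gaussianReal 0 (v i)) P) [DecidableEq ι] {a b c d : ι}
    (hab : a ≠ b) (hac : a ≠ c) (had : a ≠ d) :
    ∫ ω, x a ω * (x b ω * x c ω * x d ω) ∂P = 0 := by
  have hind := hx.indepFun_finset₀ {a} {b, c, d}
    (by simp [hab, hac, had]) (fun i => (hlaw i).aemeasurable)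
  have h2 : IndepFun (x a) (fun ω => x b ω * x c ω * x d ω) P := by
    have hb : b ∈ ({b, c, d} : Finset ι) := by simp
    have hc : c ∈ ({b, c, d} : Finset ι) := by simp
    have hd : d ∈ ({b, c, d} : Finset ι) := by simp
    have hφ : Measurable
        (fun f : ({a} : Finset ι) → ℝ => f ⟨a, Finset.mem_singleton_self a⟩) := by fun_prop
    have hψ : Measurable (fun f : ({b, c, d} : Finset ι) → ℝ =>
        f ⟨b, hb⟩ * f ⟨c, hc⟩ * f ⟨d, hd⟩) := by fun_prop
    exact hind.comp hφ hψ
  have hm := fun i => (hlaw i).aemeasurable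
  rw [h2.integral_fun_mul_eq_mul_integral (hm a).aestronglyMeasurable
    (((hm b).mul (hm c)).mul (hm d)).aestronglyMeasurable,
    (integral_comp_of_hasLaw_gaussian (hlaw a)).1, zero_mul]

theorem integral_sq_mul_sq {x : ι → Ω → ℝ} (hx : iIndepFun x P) {v : ι → ℝ≥0}
    (hlaw : ∀ i, HasLaw (x i) (gaussianReal 0 (v i)) P) {a b : ι} (hab : a ≠ b) :
    ∫ ω, x a ω ^ 2 * x b ω ^ 2 ∂P = v a * v b := by
  have h2 : IndepFun (fun ω => x a ω ^ 2) (fun ω => x b ω ^ 2) P :=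
    (hx.indepFun hab).comp (φ := fun y => y ^ 2) (ψ := fun y => y ^ 2) (by fun_prop) (by fun_prop)
  have hm := fun i => (hlaw i).aemeasurable
  rw [h2.integral_fun_mul_eq_mul_integral ((hm a).pow_const 2).aestronglyMeasurable
    ((hm b).pow_const 2).aestronglyMeasurable,
    (integral_comp_of_hasLaw_gaussian (hlaw a)).2.1,
    (integral_comp_of_hasLaw_gaussian (hlaw b)).2.1]

/-- Wick's formula for fourth moments of independent centred Gaussian variables. -/
theorem integral_wick_four {x : ι → Ω → ℝ} (hx : iIndepFun x P) {v : ι → ℝ≥0}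
    (hlaw : ∀ i, HasLaw (x i) (gaussianReal 0 (v i)) P) [DecidableEq ι] (a b c d : ι) :
    ∫ ω, x a ω * x b ω * (x c ω * x d ω) ∂P
      = (if a = b ∧ c = d then (v a : ℝ) * v c else 0)
        + (if a = c ∧ b = d then (v a : ℝ) * v b else 0)
        + (if a = d ∧ b = c then (v a : ℝ) * v b else 0) := by
  have hz := fun {a b c d : ι} => integral_mul_eq_zero_of_notMem hx hlaw (a := a) (b := b)
    (c := c) (d := d)
  have hs := fun {a b : ι} => integral_sq_mul_sq hx hlaw (a := a) (b := b)
  by_cases hab : a = b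
  · subst hab
    by_cases hcd : c = d
    · subst hcd
      by_cases hac : a = c
      · subst hac
        have := (integral_comp_of_hasLaw_gaussian (hlaw a)).2.2
        rw [show (fun ω => x a ω * x a ω * (x a ω * x a ω)) = fun ω => x a ω ^ 4 by
          funext ω; ring, this]
        simp; ring
      · rw [show (fun ω => x a ω * x a ω * (x c ω * x c ω)) = fun ω => x a ω ^ 2 * x c ω ^ 2 by
          funext ω; ring, hs hac]
        simp [hac]
    · by_cases hac : a = c
      · subst hac
        rw [show (fun ω => x a ω * x a ω * (x a ω * x d ω))
          = fun ω => x d ω * (x a ω * x a ω * x a ω) by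
          funext ω; ring, hz (Ne.symm hcd) (Ne.symm hcd) (Ne.symm hcd)]
        simp [hcd]
      · rw [show (fun ω => x a ω * x a ω * (x c ω * x d ω))
          = fun ω => x c ω * (x a ω * x a ω * x d ω) by
          funext ω; ring, hz (Ne.symm hac) (Ne.symm hac) hcd]
        simp [hcd, hac]
  · by_cases hac : a = c
    · subst hac
      by_cases hbd : b = d
      · subst hbd
        rw [show (fun ω => x a ω * x b ω * (x a ω * x b ω)) = fun ω => x a ω ^ 2 * x b ω ^ 2 by
          funext ω; ring, hs hab]
        simp [hab]
      · rw [show (fun ω => x a ω * x b ω * (x a ω * x d ω))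
          = fun ω => x b ω * (x a ω * x a ω * x d ω) by
          funext ω; ring, hz (Ne.symm hab) (Ne.symm hab) hbd]
        simp [hab, hbd, Ne.symm hab]
    · by_cases had : a = d
      · subst had
        by_cases hbc : b = c
        · subst hbc
          rw [show (fun ω => x a ω * x b ω * (x b ω * x a ω)) = fun ω => x a ω ^ 2 * x b ω ^ 2 by
            funext ω; ring, hs hab]
          simp [hab]
        · rw [show (fun ω => x a ω * x b ω * (x c ω * x a ω))
            = fun ω => x b ω * (x a ω * x c ω * x a ω) by
            funext ω; ring, hz (Ne.symm hab) hbc (Ne.symm hab)]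
          simp [hab, hbc, Ne.symm hab]
      · rw [show (fun ω => x a ω * x b ω * (x c ω * x d ω))
          = fun ω => x a ω * (x b ω * x c ω * x d ω) by
          funext ω; ring, hz hab hac had]
        simp [hab, hac, had]

theorem integral_mul_pair {x : ι → Ω → ℝ} (hx : iIndepFun x P) {v : ι → ℝ≥0}
    (hlaw : ∀ i, HasLaw (x i) (gaussianReal 0 (v i)) P) [DecidableEq ι] (a b : ι) :
    ∫ ω, x a ω * x b ω ∂P = if a = b then (v a : ℝ) else 0 := by
  by_cases hab : a = b
  · subst hab
    simp only [← pow_two]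
    simpa using (integral_comp_of_hasLaw_gaussian (hlaw a)).2.1
  · have hm := fun i => (hlaw i).aemeasurable
    rw [(hx.indepFun hab).integral_fun_mul_eq_mul_integral (hm a).aestronglyMeasurable
      (hm b).aestronglyMeasurable, (integral_comp_of_hasLaw_gaussian (hlaw a)).1]
    simp [hab]

theorem memLp_mul_pair {x : ι → Ω → ℝ} {v : ι → ℝ≥0}
    (hlaw : ∀ i, HasLaw (x i) (gaussianReal 0 (v i)) P) (a b : ι) :
    MemLp (fun ω => x a ω * x b ω) 2 P := by
  have h := fun i => memLp_of_hasLaw_gaussian (hlaw i) 4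
  have : ENNReal.HolderTriple ((4 : ℝ≥0) : ENNReal) ((4 : ℝ≥0) : ENNReal) 2 := by
    constructor
    have h2 : (2 : ENNReal) = ((2 : ℝ≥0) : ENNReal) := by norm_cast
    rw [h2, ← ENNReal.coe_inv (by norm_num), ← ENNReal.coe_inv (by norm_num), ← ENNReal.coe_add]
    congr 1
    ext
    norm_num
  exact (h b).mul' (h a)

/-- Covariances of the centred products `x a * x b` of independent Gaussian variables. -/
theorem integral_centred_mul [IsProbabilityMeasure P] {x : ι → Ω → ℝ} (hx : iIndepFun x P)
    {v : ι → ℝ≥0}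
    (hlaw : ∀ i, HasLaw (x i) (gaussianReal 0 (v i)) P) [DecidableEq ι] (a b c d : ι) :
    ∫ ω, (x a ω * x b ω - if a = b then (v a : ℝ) else 0)
        * (x c ω * x d ω - if c = d then (v c : ℝ) else 0) ∂P
      = (if a = c ∧ b = d then (v a : ℝ) * v b else 0)
        + (if a = d ∧ b = c then (v a : ℝ) * v b else 0) := by
  set p := if a = b then (v a : ℝ) else 0 with hp
  set q := if c = d then (v c : ℝ) else 0 with hq
  have h1 := memLp_mul_pair hlaw a b
  have h2 := memLp_mul_pair hlaw c d
  have i1 : Integrable (fun ω => x a ω * x b ω) P := h1.integrable (by norm_num)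
  have i2 : Integrable (fun ω => x c ω * x d ω) P := h2.integrable (by norm_num)
  have i12 : Integrable (fun ω => x a ω * x b ω * (x c ω * x d ω)) P := h1.integrable_mul h2
  have e : (fun ω => (x a ω * x b ω - p) * (x c ω * x d ω - q))
      = fun ω => (x a ω * x b ω * (x c ω * x d ω) - q * (x a ω * x b ω))
        - (p * (x c ω * x d ω) - p * q) := by funext ω; ring
  have j1 : Integrable (fun ω => x a ω * x b ω * (x c ω * x d ω) - q * (x a ω * x b ω)) P :=
    i12.sub (i1.const_mul q)
  have j2 : Integrable (fun ω => p * (x c ω * x d ω) - p * q) P :=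
    (i2.const_mul p).sub (integrable_const _)
  rw [e, integral_sub j1 j2,
    integral_sub i12 (i1.const_mul q), integral_sub (i2.const_mul p) (integrable_const _),
    integral_const_mul, integral_const_mul, integral_wick_four hx hlaw, integral_mul_pair hx hlaw,
    integral_mul_pair hx hlaw, ← hp, ← hq, integral_const, probReal_univ, one_smul]
  have : (if a = b ∧ c = d then (v a : ℝ) * v c else 0) = p * q := by
    rw [hp, hq]; split_ifs <;> simp_all
  rw [this]; ring

/-- When the square is expanded, independence factors each term into a covariance of centred
products and a moment of R. Only q = p and q = p.swap survive, and symmetry of R makes their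
contributions equal, whence the 2. On the diagonal both occur at once, in agreement with Var(x²) =
2v². -/
theorem integral_sq_quadraticForm [IsProbabilityMeasure P] [Fintype ι] [DecidableEq ι]
    {x : ι → Ω → ℝ} (hx : iIndepFun x P) {v : ι → ℝ≥0}
    (hlaw : ∀ i, HasLaw (x i) (gaussianReal 0 (v i)) P) {R : ι × ι → Ω → ℝ}
    (hRm : ∀ p, AEMeasurable (R p) P) {B : ℝ} (hB : ∀ p ω, |R p ω| ≤ B)
    (hsym : ∀ j k ω, R (j, k) ω = R (k, j) ω)
    (hind : IndepFun (fun ω j => x j ω) (fun ω p => R p ω) P) :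
    Integrable (fun ω => (∑ p : ι × ι,
      (x p.1 ω * x p.2 ω - if p.1 = p.2 then (v p.1 : ℝ) else 0) * R p ω) ^ 2) P ∧
    ∫ ω, (∑ p : ι × ι,
      (x p.1 ω * x p.2 ω - if p.1 = p.2 then (v p.1 : ℝ) else 0) * R p ω) ^ 2 ∂P
      = 2 * ∑ p : ι × ι, (v p.1 : ℝ) * v p.2 * ∫ ω, R p ω ^ 2 ∂P := by
  set T : ι × ι → Ω → ℝ := fun p ω => x p.1 ω * x p.2 ω - if p.1 = p.2 then (v p.1 : ℝ) else 0
    with hT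
  have hTL : ∀ p, MemLp (T p) 2 P := fun p => (memLp_mul_pair hlaw p.1 p.2).sub (memLp_const _)
  have hTT : ∀ p q, Integrable (fun ω => T p ω * T q ω) P := fun p q =>
    (hTL p).integrable_mul (hTL q)
  have hRR : ∀ p q, AEStronglyMeasurable (fun ω => R p ω * R q ω) P := fun p q =>
    ((hRm p).mul (hRm q)).aestronglyMeasurable
  have hRRb : ∀ p q ω, ‖R p ω * R q ω‖ ≤ B * B := fun p q ω => by
    rw [norm_mul]
    exact mul_le_mul (hB p ω) (hB q ω) (norm_nonneg _) ((abs_nonneg _).trans (hB p ω))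
  have hI : ∀ p q, Integrable (fun ω => T p ω * T q ω * (R p ω * R q ω)) P := fun p q =>
    (hTT p q).mul_bdd (c := B * B) (hRR p q) (Eventually.of_forall (hRRb p q))
  have hexp : (fun ω => (∑ p : ι × ι, T p ω * R p ω) ^ 2)
      = fun ω => ∑ p : ι × ι, ∑ q : ι × ι, T p ω * T q ω * (R p ω * R q ω) := by
    funext ω
    rw [pow_two, Finset.sum_mul_sum]
    refine Finset.sum_congr rfl fun p _ => Finset.sum_congr rfl fun q _ => ?_
    ring
  have hE : ∀ p q, ∫ ω, T p ω * T q ω * (R p ω * R q ω) ∂P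
      = ((if p = q then (v p.1 : ℝ) * v p.2 else 0)
        + (if p = q.swap then (v p.1 : ℝ) * v p.2 else 0)) * ∫ ω, R p ω * R q ω ∂P := by
    intro p q
    have h := hind.comp
      (φ := fun y : ι → ℝ => (y p.1 * y p.2 - if p.1 = p.2 then (v p.1 : ℝ) else 0)
        * (y q.1 * y q.2 - if q.1 = q.2 then (v q.1 : ℝ) else 0))
      (ψ := fun r : ι × ι → ℝ => r p * r q) (by fun_prop) (by fun_prop)
    have h' : IndepFun (fun ω => T p ω * T q ω) (fun ω => R p ω * R q ω) P := h
    rw [h'.integral_fun_mul_eq_mul_integral (hTT p q).aestronglyMeasurable (hRR p q)]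
    congr 1
    rw [hT]
    simp only
    rw [integral_centred_mul hx hlaw]
    congr 2
    · simp [Prod.ext_iff]
    · simp [Prod.ext_iff]
  rw [hexp]
  refine ⟨integrable_finsetSum _ fun p _ => integrable_finsetSum _ fun q _ => hI p q, ?_⟩
  rw [integral_finsetSum _ fun p _ => integrable_finsetSum _ fun q _ => hI p q, Finset.mul_sum]
  refine Finset.sum_congr rfl fun p _ => ?_
  rw [integral_finsetSum _ fun q _ => hI p q]
  simp only [hE, add_mul, Finset.sum_add_distrib]
  have e1 : ∑ q, (if p = q then (v p.1 : ℝ) * v p.2 else 0) * ∫ ω, R p ω * R q ω ∂P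
      = (v p.1 : ℝ) * v p.2 * ∫ ω, R p ω ^ 2 ∂P := by
    rw [Finset.sum_eq_single p (fun q _ hq => by simp [Ne.symm hq]) (by simp)]
    simp [pow_two]
  have e2 : ∑ q : ι × ι, (if p = q.swap then (v p.1 : ℝ) * v p.2 else 0) * ∫ ω, R p ω * R q ω ∂P
      = (v p.1 : ℝ) * v p.2 * ∫ ω, R p ω ^ 2 ∂P := by
    rw [Finset.sum_eq_single p.swap (fun q _ hq => by
      rw [if_neg (fun h => hq (by rw [h, Prod.swap_swap])), zero_mul]) (by simp)]
    have : ∀ ω, R p.swap ω = R p ω := fun ω => hsym p.2 p.1 ω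
    simp [pow_two, this]
  rw [e1, e2]
  ring

/-- Real and imaginary parts are treated separately and recombined. In ∑ v_j v_k E|R_jk|² one
variance is bounded by `M`, the k-sum of |R_jk|² by `D`, and the remaining sum of variances by `V`.
The factor `M` is what eventually becomes small. -/
theorem integral_norm_sq_quadraticForm_le [IsProbabilityMeasure P] [Fintype ι] [DecidableEq ι]
    {x : ι → Ω → ℝ} (hx : iIndepFun x P) {v : ι → ℝ≥0}
    (hlaw : ∀ i, HasLaw (x i) (gaussianReal 0 (v i)) P) {R : ι × ι → Ω → ℂ}
    (hRm : ∀ p, AEMeasurable (R p) P) {B D M V : ℝ} (hB : ∀ p ω, ‖R p ω‖ ≤ B)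
    (hsym : ∀ j k ω, R (j, k) ω = R (k, j) ω)
    (hind : IndepFun (fun ω j => x j ω) (fun ω p => R p ω) P)
    (hD : ∀ j ω, ∑ k, ‖R (j, k) ω‖ ^ 2 ≤ D) (hM : ∀ i, (v i : ℝ) ≤ M) (hV : ∑ i, (v i : ℝ) ≤ V)
    (hM0 : 0 ≤ M) (hD0 : 0 ≤ D) :
    Integrable (fun ω => ‖∑ j, ∑ k, (x j ω : ℂ) * x k ω * R (j, k) ω
      - ∑ j, (v j : ℂ) * R (j, j) ω‖ ^ 2) P ∧
    ∫ ω, ‖∑ j, ∑ k, (x j ω : ℂ) * x k ω * R (j, k) ω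
      - ∑ j, (v j : ℂ) * R (j, j) ω‖ ^ 2 ∂P ≤ 2 * M * V * D := by
  obtain ⟨ir, er⟩ := integral_sq_quadraticForm hx hlaw (R := fun p ω => (R p ω).re)
    (fun p => Complex.measurable_re.comp_aemeasurable (hRm p))
    (fun p ω => (Complex.abs_re_le_norm _).trans (hB p ω)) (fun j k ω => by rw [hsym])
    (hind.comp (φ := fun y : ι → ℝ => y) (ψ := fun (r : ι × ι → ℂ) p => (r p).re)
      (by fun_prop) (by fun_prop))
  obtain ⟨ii, ei⟩ := integral_sq_quadraticForm hx hlaw (R := fun p ω => (R p ω).im)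
    (fun p => Complex.measurable_im.comp_aemeasurable (hRm p))
    (fun p ω => (Complex.abs_im_le_norm _).trans (hB p ω)) (fun j k ω => by rw [hsym])
    (hind.comp (φ := fun y : ι → ℝ => y) (ψ := fun (r : ι × ι → ℂ) p => (r p).im)
      (by fun_prop) (by fun_prop))
  have hQ : ∀ ω, ∑ j, ∑ k, (x j ω : ℂ) * x k ω * R (j, k) ω - ∑ j, (v j : ℂ) * R (j, j) ω
      = ∑ p : ι × ι,
        ((x p.1 ω * x p.2 ω - if p.1 = p.2 then (v p.1 : ℝ) else 0 : ℝ) : ℂ) * R p ω := by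
    intro ω
    rw [Fintype.sum_prod_type, ← Finset.sum_sub_distrib]
    refine Finset.sum_congr rfl fun j _ => ?_
    have : ∀ k, ((x j ω * x k ω - if j = k then (v j : ℝ) else 0 : ℝ) : ℂ) * R (j, k) ω
        = (x j ω : ℂ) * x k ω * R (j, k) ω - (if j = k then (v j : ℂ) * R (j, j) ω else 0) := by
      intro k
      split_ifs with h
      · subst h; push_cast; ring
      · push_cast; ring
    simp only [this, Finset.sum_sub_distrib, Finset.sum_ite_eq, Finset.mem_univ, if_true]
  have hN : (fun ω => ‖∑ j, ∑ k, (x j ω : ℂ) * x k ω * R (j, k) ω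
      - ∑ j, (v j : ℂ) * R (j, j) ω‖ ^ 2) = fun ω => (∑ p : ι × ι,
      (x p.1 ω * x p.2 ω - if p.1 = p.2 then (v p.1 : ℝ) else 0) * (R p ω).re) ^ 2
      + (∑ p : ι × ι,
      (x p.1 ω * x p.2 ω - if p.1 = p.2 then (v p.1 : ℝ) else 0) * (R p ω).im) ^ 2 := by
    funext ω
    rw [hQ, Complex.sq_norm, Complex.normSq_apply, Complex.re_sum, Complex.im_sum]
    simp only [Complex.re_ofReal_mul, Complex.im_ofReal_mul]
    ring
  rw [hN]
  refine ⟨ir.add ii, ?_⟩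
  rw [integral_add ir ii, er, ei, ← mul_add, ← Finset.sum_add_distrib]
  have hb : ∀ p (f : ℂ → ℝ), Continuous f → (∀ z, |f z| ≤ ‖z‖) →
      Integrable (fun ω => f (R p ω) ^ 2) P := by
    intro p f hf hfb
    refine Integrable.of_bound (((hf.measurable.comp_aemeasurable (hRm p)).pow_const
      2).aestronglyMeasurable) (B ^ 2) (Eventually.of_forall fun ω => ?_)
    rw [norm_pow, Real.norm_eq_abs]
    exact pow_le_pow_left₀ (abs_nonneg _) ((hfb _).trans (hB p ω)) 2
  have hb3 : ∀ p, Integrable (fun ω => ‖R p ω‖ ^ 2) P := fun p =>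
    hb p _ continuous_norm (fun z => by simp)
  have e : ∀ p : ι × ι, (v p.1 : ℝ) * v p.2 * ∫ ω, (R p ω).re ^ 2 ∂P
      + (v p.1 : ℝ) * v p.2 * ∫ ω, (R p ω).im ^ 2 ∂P
      = (v p.1 : ℝ) * v p.2 * ∫ ω, ‖R p ω‖ ^ 2 ∂P := by
    intro p
    rw [← mul_add, ← integral_add (hb p _ Complex.continuous_re Complex.abs_re_le_norm)
      (hb p _ Complex.continuous_im Complex.abs_im_le_norm)]
    congr 2
    funext ω
    rw [Complex.sq_norm, Complex.normSq_apply]; ring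
  simp only [e]
  rw [Fintype.sum_prod_type]
  have hrow : ∀ j, ∑ k, (v j : ℝ) * v k * ∫ ω, ‖R (j, k) ω‖ ^ 2 ∂P ≤ v j * (M * D) := by
    intro j
    calc ∑ k, (v j : ℝ) * v k * ∫ ω, ‖R (j, k) ω‖ ^ 2 ∂P
        ≤ ∑ k, (v j : ℝ) * M * ∫ ω, ‖R (j, k) ω‖ ^ 2 ∂P := by
          refine Finset.sum_le_sum fun k _ => ?_
          have : 0 ≤ ∫ ω, ‖R (j, k) ω‖ ^ 2 ∂P := integral_nonneg fun ω => by positivity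
          have := hM k
          gcongr
      _ = (v j : ℝ) * (M * ∫ ω, ∑ k, ‖R (j, k) ω‖ ^ 2 ∂P) := by
          rw [integral_finsetSum _ fun k _ => hb3 (j, k), ← Finset.mul_sum]; ring
      _ ≤ v j * (M * D) := by
          gcongr
          calc ∫ ω, ∑ k, ‖R (j, k) ω‖ ^ 2 ∂P ≤ ∫ ω, D ∂P :=
                integral_mono (integrable_finsetSum _ fun k _ => hb3 (j, k)) (integrable_const _)
                  (hD j)
            _ = D := by simp
  calc _ ≤ 2 * ∑ j, (v j : ℝ) * (M * D) := by
        gcongr with j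
        exact hrow j
    _ = 2 * ((∑ j, (v j : ℝ)) * (M * D)) := by rw [Finset.sum_mul]
    _ ≤ 2 * (V * (M * D)) := by gcongr
    _ = _ := by ring

end Wick

/-! ### Measurability of the resolvent entries, through the cofactor formula for the inverse. -/

section Measurability

variable {α : Type*} [MeasurableSpace α] {ι : Type*} [Fintype ι] [DecidableEq ι]

theorem measurable_matrix_det {f : α → Matrix ι ι ℂ} (hf : ∀ i j, Measurable fun a => f a i j) :
    Measurable fun a => (f a).det := by
  simp only [Matrix.det_apply']
  exact Finset.measurable_fun_sum _ fun σ _ =>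
    (Finset.measurable_fun_prod _ fun i _ => hf _ _).const_mul _

theorem measurable_matrix_inv {f : α → Matrix ι ι ℂ} (hf : ∀ i j, Measurable fun a => f a i j)
    (i j : ι) : Measurable fun a => (f a)⁻¹ i j := by
  simp only [Matrix.inv_def, Ring.inverse_eq_inv', Matrix.smul_apply, smul_eq_mul,
    Matrix.adjugate_apply]
  refine (measurable_matrix_det hf).inv.mul (measurable_matrix_det fun k l => ?_)
  by_cases h : k = j
  · subst h; simp
  · simpa [Matrix.updateRow_ne h] using hf k l

theorem measurable_matrixResolvent {f : α → Matrix ι ι ℝ}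
    (hf : ∀ i j, Measurable fun a => f a i j) (z : ℂ) (i j : ι) :
    Measurable fun a => matrixResolvent (f a) z i j := by
  unfold matrixResolvent
  refine measurable_matrix_inv (fun k l => ?_) i j
  simp only [Matrix.sub_apply, Matrix.map_apply]
  exact (Complex.measurable_ofReal.comp (hf k l)).sub_const _

end Measurability

/-! ### The averaged self-consistent estimate for Gaussian symmetric matrices. -/

section RandomMatrix

variable {Ω : Type*} [MeasurableSpace Ω] {P : Measure Ω} {ι : Type*} [Fintype ι] [LinearOrder ι]

/-- The index of the entry `(j, k)` in the upper triangle. -/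
def upperIndex (j k : ι) : {p : ι × ι // p.1 ≤ p.2} := ⟨(min j k, max j k), min_le_max⟩

omit [Fintype ι] in
theorem apply_upperIndex {A : Matrix ι ι ℝ} (hA : A.IsSymm) (j k : ι) :
    A (upperIndex j k).1.1 (upperIndex j k).1.2 = A j k := by
  unfold upperIndex
  rcases le_total j k with h | h
  · simp [h]
  · simp [h, hA.apply]

omit [Fintype ι] in
theorem upperIndex_injective (i : ι) : Function.Injective (upperIndex i) := by
  intro j k h
  unfold upperIndex at h
  simp only [Subtype.mk.injEq, Prod.mk.injEq] at h
  grind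

omit [Fintype ι] [LinearOrder ι] in
theorem isHermitian_of_isSymm {A : Matrix ι ι ℝ} (hA : A.IsSymm) : A.IsHermitian := by
  rw [Matrix.IsHermitian, Matrix.conjTranspose_eq_transpose_of_trivial, hA.eq]

theorem aemeasurable_matrixResolvent {X : Ω → Matrix ι ι ℝ}
    (hm : ∀ i j, AEMeasurable (fun ω => X ω i j) P) (z : ℂ) (i j : ι) :
    AEMeasurable (fun ω => matrixResolvent (X ω) z i j) P := by
  have h1 : AEMeasurable (fun ω (p : ι × ι) => X ω p.1 p.2) P :=
    aemeasurable_pi_lambda _ fun p => hm p.1 p.2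
  let N : (ι × ι → ℝ) → Matrix ι ι ℝ := fun y => Matrix.of fun j k => y (j, k)
  have hN : ∀ ω, N (fun p => X ω p.1 p.2) = X ω := fun ω => by ext j k; rfl
  have h2 := (measurable_matrixResolvent (f := N)
    (fun j k => measurable_pi_apply (j, k)) z i j).comp_aemeasurable h1
  refine h2.congr (Eventually.of_forall fun ω => ?_)
  simp only [Function.comp_apply, hN]

/-- Row i depends only on the upper-triangular entries with an index equal to i, and the minor
resolvent only on the complementary entries; these two groups are independent. -/
theorem indepFun_row_minorResolvent {X : Ω → Matrix ι ι ℝ} (hsymm : ∀ ω, (X ω).IsSymm)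
    (hindep : iIndepFun (fun (p : {p : ι × ι // p.1 ≤ p.2}) (ω : Ω) => X ω p.1.1 p.1.2) P)
    (hm : ∀ i j, AEMeasurable (fun ω => X ω i j) P) (z : ℂ) (i : ι) :
    IndepFun (fun ω j => X ω i j)
      (fun ω (p : ι × ι) => minorResolvent (X ω) z i p.1 p.2) P := by
  classical
  let S : Finset {p : ι × ι // p.1 ≤ p.2} := Finset.univ.filter fun p => p.1.1 = i ∨ p.1.2 = i
  have h := hindep.indepFun_finset₀ S Sᶜ disjoint_compl_right (fun p => hm _ _)
  have hS : ∀ j, upperIndex i j ∈ S := by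
    intro j
    simp only [S, upperIndex, Finset.mem_filter, Finset.mem_univ, true_and]
    rcases le_total i j with h | h <;> simp [h]
  have hSc : ∀ j k, j ≠ i ∧ k ≠ i → upperIndex j k ∈ Sᶜ := by
    intro j k hjk
    simp only [S, upperIndex, Finset.mem_compl, Finset.mem_filter, Finset.mem_univ, true_and]
    rcases le_total j k with h | h <;> simp [h, hjk.1, hjk.2]
  have hφ : Measurable (fun (y : S → ℝ) j => y ⟨upperIndex i j, hS j⟩) := by fun_prop
  -- `N` rebuilds the matrix with cross i zeroed from the entries outside the cross alone.
  let N : (↥(Sᶜ) → ℝ) → Matrix ι ι ℝ := fun y => Matrix.of fun j k =>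
    if hjk : j ≠ i ∧ k ≠ i then y ⟨upperIndex j k, hSc j k hjk⟩ else 0
  have hN : ∀ j k, Measurable fun y => N y j k := by
    intro j k
    by_cases hjk : j ≠ i ∧ k ≠ i
    · simp only [N, Matrix.of_apply, dif_pos hjk]; fun_prop
    · simp only [N, Matrix.of_apply, dif_neg hjk]; fun_prop
  have hψ : Measurable (fun (y : ↥(Sᶜ) → ℝ) (p : ι × ι) =>
      zeroCross (matrixResolvent (N y) z) i p.1 p.2) := by
    refine measurable_pi_lambda _ fun p => ?_
    simp only [zeroCross, Matrix.of_apply]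
    by_cases hp : p.1 = i ∨ p.2 = i
    · simp only [if_pos hp]; fun_prop
    · simp only [if_neg hp]; exact measurable_matrixResolvent hN z _ _
  have h2 := h.comp hφ hψ
  have e1 : (fun (y : S → ℝ) j => y ⟨upperIndex i j, hS j⟩) ∘
      (fun ω (p : S) => X ω p.1.1.1 p.1.1.2) = fun ω j => X ω i j := by
    funext ω j
    exact apply_upperIndex (hsymm ω) i j
  have e2 : (fun (y : ↥(Sᶜ) → ℝ) (p : ι × ι) => zeroCross (matrixResolvent (N y) z) i p.1 p.2) ∘
      (fun ω (p : ↥(Sᶜ)) => X ω p.1.1.1 p.1.1.2)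
      = fun ω (p : ι × ι) => minorResolvent (X ω) z i p.1 p.2 := by
    funext ω p
    have : N (fun (p : ↥(Sᶜ)) => X ω p.1.1.1 p.1.1.2) = zeroCross (X ω) i := by
      ext j k
      simp only [N, zeroCross, Matrix.of_apply]
      by_cases hjk : j ≠ i ∧ k ≠ i
      · rw [dif_pos hjk, apply_upperIndex (hsymm ω), if_neg (by tauto)]
      · rw [dif_neg hjk, if_pos (by tauto)]
    simp only [Function.comp_apply, this, minorResolvent]
  rw [e1, e2] at h2
  exact h2

theorem aemeasurable_minorResolvent {X : Ω → Matrix ι ι ℝ}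
    (hm : ∀ i j, AEMeasurable (fun ω => X ω i j) P) (z : ℂ) (i : ι) (j k : ι) :
    AEMeasurable (fun ω => minorResolvent (X ω) z i j k) P := by
  by_cases hp : j = i ∨ k = i
  · simp only [minorResolvent, zeroCross, Matrix.of_apply, if_pos hp]; fun_prop
  · simp only [minorResolvent]
    conv =>
      enter [1, ω]
      rw [zeroCross]
      simp only [Matrix.of_apply, if_neg hp]
    refine aemeasurable_matrixResolvent (fun a b => ?_) z j k
    by_cases hp : a = i ∨ b = i
    · simp only [zeroCross, Matrix.of_apply, if_pos hp]; fun_prop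
    · simp only [zeroCross, Matrix.of_apply, if_neg hp]; exact hm a b

/-- Passes from first moments to the available second moments at the cost of a free parameter δ,
which is fixed only in the final limit. -/
theorem le_add_sq_div {δ : ℝ} (hδ : 0 < δ) (x : ℝ) : x ≤ δ + x ^ 2 / δ := by
  rw [← sub_nonneg]
  have : δ + x ^ 2 / δ - x = ((x - δ / 2) ^ 2 + 3 / 4 * δ ^ 2) / δ := by field_simp; ring
  rw [this]; positivity

variable [IsProbabilityMeasure P]

theorem integrable_norm_matrixResolvent_sub {X : Ω → Matrix ι ι ℝ} (hsymm : ∀ ω, (X ω).IsSymm)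
    (hm : ∀ i j, AEMeasurable (fun ω => X ω i j) P) {z : ℂ} (hz : 0 < z.im) (m : ℂ) (i : ι) :
    Integrable (fun ω => ‖matrixResolvent (X ω) z i i - m‖) P := by
  refine Integrable.norm (Integrable.sub ?_ (integrable_const m))
  exact Integrable.of_bound (aemeasurable_matrixResolvent hm z i i).aestronglyMeasurable
    (1 / z.im) (Eventually.of_forall fun ω =>
      norm_matrixResolvent_diag_le (isHermitian_of_isSymm (hsymm ω)) hz i)

theorem integral_norm_matrixResolvent_sub_le {X : Ω → Matrix ι ι ℝ} (hsymm : ∀ ω, (X ω).IsSymm)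
    (hindep : iIndepFun (fun (p : {p : ι × ι // p.1 ≤ p.2}) (ω : Ω) => X ω p.1.1 p.1.2) P)
    {s : ι → ι → ℝ≥0} (hlaw : ∀ i j, HasLaw (fun ω => X ω i j) (gaussianReal 0 (s i j)) P)
    {z m : ℂ} (hz : 0 < z.im) (hm : m * (-z - m) = 1) (hmb : ‖m‖ ≤ 1 / z.im) (i : ι) {M V δ : ℝ}
    (hδ : 0 < δ) (hM : ∀ j, (s i j : ℝ) ≤ M) (hV : ∑ j, (s i j : ℝ) ≤ V) :
    ∫ ω, ‖matrixResolvent (X ω) z i i - m‖ ∂P ≤ (1 / z.im ^ 2) * (2 * δ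
      + M * (1 / δ + 2 * V / (z.im ^ 2 * δ) + 1 / z.im)
      + ∑ j, (s i j : ℝ) * ∫ ω, ‖matrixResolvent (X ω) z j j - m‖ ∂P
      + |∑ j, (s i j : ℝ) - 1| / z.im) := by
  have hme : ∀ i j, AEMeasurable (fun ω => X ω i j) P := fun i j => (hlaw i j).aemeasurable
  have hH : ∀ ω, (X ω).IsHermitian := fun ω => isHermitian_of_isSymm (hsymm ω)
  have hM0 : 0 ≤ M := (s i i).2.trans (hM i)
  have hrow : iIndepFun (fun j ω => X ω i j) P := by
    have := hindep.precomp (upperIndex_injective i)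
    convert this using 2 with j
    funext ω
    exact (apply_upperIndex (hsymm ω) i j).symm
  obtain ⟨iQ, eQ⟩ := integral_norm_sq_quadraticForm_le hrow (v := s i) (hlaw i)
    (R := fun p ω => minorResolvent (X ω) z i p.1 p.2)
    (fun p => aemeasurable_minorResolvent hme z i p.1 p.2)
    (B := 1 / z.im) (D := 1 / z.im ^ 2) (M := M) (V := V)
    (fun p ω => norm_minorResolvent_le (hH ω) hz i p.1 p.2)
    (fun j k ω => minorResolvent_symm (hH ω) z i j k)
    (indepFun_row_minorResolvent hsymm hindep hme z i)
    (fun j ω => sum_norm_sq_minorResolvent_le (hH ω) hz i j) hM hV hM0 (by positivity)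
  set Q : Ω → ℂ := fun ω => ∑ j, ∑ k, (X ω i j : ℂ) * X ω i k * minorResolvent (X ω) z i j k
      - ∑ j, (s i j : ℂ) * minorResolvent (X ω) z i j j with hQ
  have iX : Integrable (fun ω => X ω i i ^ 2) P :=
    (memLp_of_hasLaw_gaussian (hlaw i i) 2).integrable_sq
  have eX := (integral_comp_of_hasLaw_gaussian (hlaw i i)).2.1
  have iG := fun j => integrable_norm_matrixResolvent_sub hsymm hme hz m j
  have iS : Integrable (fun ω => ∑ j, (s i j : ℝ) * ‖matrixResolvent (X ω) z j j - m‖) P :=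
    integrable_finsetSum _ fun j _ => (iG j).const_mul _
  have hpt : ∀ ω, ‖matrixResolvent (X ω) z i i - m‖ ≤ (1 / z.im ^ 2) * (2 * δ
      + X ω i i ^ 2 / δ + ‖Q ω‖ ^ 2 / δ + M / z.im
      + ∑ j, (s i j : ℝ) * ‖matrixResolvent (X ω) z j j - m‖
      + |∑ j, (s i j : ℝ) - 1| / z.im) := by
    intro ω
    refine (norm_matrixResolvent_diag_sub_le (hH ω) hz hm hmb i (s := fun j => (s i j : ℝ))
      (fun j => (s i j).2) hM).trans ?_
    refine mul_le_mul_of_nonneg_left ?_ (by positivity)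
    have h1 := le_add_sq_div hδ |X ω i i|
    have h2 := le_add_sq_div hδ ‖Q ω‖
    rw [sq_abs] at h1
    have h3 : ‖∑ j, ∑ k, (X ω i j : ℂ) * X ω i k * minorResolvent (X ω) z i j k
      - ∑ j, ((s i j : ℝ) : ℂ) * minorResolvent (X ω) z i j j‖ = ‖Q ω‖ := rfl
    rw [h3]
    linarith
  have j1 : Integrable (fun ω => 2 * δ + X ω i i ^ 2 / δ) P :=
    (integrable_const _).add (iX.div_const δ)
  have j2 : Integrable (fun ω => 2 * δ + X ω i i ^ 2 / δ + ‖Q ω‖ ^ 2 / δ) P :=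
    j1.add (iQ.div_const δ)
  have j3 : Integrable (fun ω => 2 * δ + X ω i i ^ 2 / δ + ‖Q ω‖ ^ 2 / δ + M / z.im) P :=
    j2.add (integrable_const _)
  have j4 : Integrable (fun ω => 2 * δ + X ω i i ^ 2 / δ + ‖Q ω‖ ^ 2 / δ + M / z.im
      + ∑ j, (s i j : ℝ) * ‖matrixResolvent (X ω) z j j - m‖) P := j3.add iS
  have j5 : Integrable (fun ω => 2 * δ + X ω i i ^ 2 / δ + ‖Q ω‖ ^ 2 / δ + M / z.im
      + ∑ j, (s i j : ℝ) * ‖matrixResolvent (X ω) z j j - m‖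
      + |∑ j, (s i j : ℝ) - 1| / z.im) P := j4.add (integrable_const _)
  refine (integral_mono (iG i) (j5.const_mul _) hpt).trans ?_
  rw [integral_const_mul, integral_add j4 (integrable_const _), integral_add j3 iS,
    integral_add j2 (integrable_const _), integral_add j1 (iQ.div_const δ),
    integral_add (integrable_const _) (iX.div_const δ), integral_div, integral_div, eX,
    integral_finsetSum _ fun j _ => (iG j).const_mul _]
  simp only [integral_const, probReal_univ, one_smul, integral_const_mul]
  refine mul_le_mul_of_nonneg_left ?_ (by positivity)
  have k1 : (s i i : ℝ) / δ ≤ M / δ := by gcongr; exact hM i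
  have k2 : (∫ ω, ‖Q ω‖ ^ 2 ∂P) / δ ≤ 2 * M * V * (1 / z.im ^ 2) / δ := by gcongr
  have k3 : M * (1 / δ + 2 * V / (z.im ^ 2 * δ) + 1 / z.im)
      = M / δ + 2 * M * V * (1 / z.im ^ 2) / δ + M / z.im := by field_simp
  rw [k3]
  linarith

/-- Summing the single-row estimates turns the self-consistent term into a sum weighted by column
sums of the variances, which equal row sums by symmetry and are at most `V`. As V ≤ (Im z)²/2, this
is at most half of the left side; absorbing it changes the prefactor from 1 / (Im z)² to 2 / (Im
z)². -/
theorem sum_integral_norm_matrixResolvent_sub_le {X : Ω → Matrix ι ι ℝ}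
    (hsymm : ∀ ω, (X ω).IsSymm)
    (hindep : iIndepFun (fun (p : {p : ι × ι // p.1 ≤ p.2}) (ω : Ω) => X ω p.1.1 p.1.2) P)
    {s : ι → ι → ℝ≥0} (hlaw : ∀ i j, HasLaw (fun ω => X ω i j) (gaussianReal 0 (s i j)) P)
    {z m : ℂ} (hz : 0 < z.im) (hm : m * (-z - m) = 1) (hmb : ‖m‖ ≤ 1 / z.im) {M : ι → ℝ} {V δ : ℝ}
    (hδ : 0 < δ) (hM : ∀ i j, (s i j : ℝ) ≤ M i) (hV : ∀ i, ∑ j, (s i j : ℝ) ≤ V)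
    (hVz : V ≤ z.im ^ 2 / 2) :
    ∑ i, ∫ ω, ‖matrixResolvent (X ω) z i i - m‖ ∂P ≤ (2 / z.im ^ 2) * (2 * Fintype.card ι * δ
      + (∑ i, M i) * (1 / δ + 2 * V / (z.im ^ 2 * δ) + 1 / z.im)
      + (∑ i, |∑ j, (s i j : ℝ) - 1|) / z.im) := by
  set E : ι → ℝ := fun i => ∫ ω, ‖matrixResolvent (X ω) z i i - m‖ ∂P with hE
  have hE0 : ∀ i, 0 ≤ E i := fun i => integral_nonneg fun ω => norm_nonneg _
  have hs : ∀ i j, s i j = s j i := by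
    intro i j
    have h1 := (integral_comp_of_hasLaw_gaussian (hlaw i j)).2.1
    have h2 := (integral_comp_of_hasLaw_gaussian (hlaw j i)).2.1
    have : (fun ω => X ω i j ^ 2) = fun ω => X ω j i ^ 2 := by
      funext ω; rw [(hsymm ω).apply]
    rw [this, h2] at h1
    exact_mod_cast h1.symm
  have hcol : ∑ i, ∑ j, (s i j : ℝ) * E j ≤ V * ∑ j, E j := by
    rw [Finset.sum_comm, Finset.mul_sum]
    refine Finset.sum_le_sum fun j _ => ?_
    rw [← Finset.sum_mul]
    refine mul_le_mul_of_nonneg_right ?_ (hE0 j)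
    simp only [hs _ j]
    exact hV j
  have h := Finset.sum_le_sum fun i (_ : i ∈ Finset.univ) =>
    integral_norm_matrixResolvent_sub_le hsymm hindep hlaw hz hm hmb i hδ (hM i) (hV i)
  rw [← Finset.mul_sum, Finset.sum_add_distrib, Finset.sum_add_distrib, Finset.sum_add_distrib,
    ← Finset.sum_div] at h
  have hE' : ∀ i, ∫ ω, ‖matrixResolvent (X ω) z i i - m‖ ∂P = E i := fun i => rfl
  simp only [hE'] at h
  simp only [Finset.sum_const, Finset.card_univ, nsmul_eq_mul] at h
  rw [← Finset.sum_mul Finset.univ M] at h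
  have hT : 0 ≤ ∑ j, E j := Finset.sum_nonneg fun j _ => hE0 j
  have hz2 : 0 < z.im ^ 2 := by positivity
  have hcol2 : ∑ i, ∑ j, (s i j : ℝ) * E j ≤ z.im ^ 2 / 2 * ∑ j, E j :=
    hcol.trans (mul_le_mul_of_nonneg_right hVz hT)
  rw [div_mul_eq_mul_div, one_mul, le_div_iff₀ hz2] at h
  rw [div_mul_eq_mul_div, le_div_iff₀ hz2]
  linarith

end RandomMatrix

/-! ### Measurability of the ordered eigenvalues. -/

section Eigenvalues

variable {α : Type*} [MeasurableSpace α] {ι : Type*} [Fintype ι] [DecidableEq ι]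

theorem trace_pow_eq_sum_eigenvalues_pow {A : Matrix ι ι ℝ} (hA : A.IsHermitian) (k : ℕ) :
    (A ^ k).trace = ∑ i, hA.eigenvalues i ^ k := by
  have h : (A ^ k).trace = _ := congrArg (fun B => (B ^ k).trace) hA.spectral_theorem
  rw [h, ← map_pow, Unitary.conjStarAlgAut_apply, Matrix.trace_mul_comm, ← mul_assoc,
    Unitary.star_mul_self_of_mem hA.eigenvectorUnitary.2, one_mul, Matrix.diagonal_pow,
    Matrix.trace_diagonal]
  simp

theorem measurable_matrix_pow {f : α → Matrix ι ι ℝ} (hf : ∀ i j, Measurable fun a => f a i j)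
    (k : ℕ) : ∀ i j, Measurable fun a => (f a ^ k) i j := by
  induction k with
  | zero => intro i j; simp
  | succ k ih =>
    intro i j
    simp only [pow_succ, Matrix.mul_apply]
    exact Finset.measurable_fun_sum _ fun l _ => (ih i l).mul (hf l j)

/-- Power sums of eigenvalues are traces of powers, hence polynomials in the entries. -/
theorem measurable_sum_polynomial_eigenvalues {f : α → Matrix ι ι ℝ}
    (hf : ∀ i j, Measurable fun a => f a i j) (hH : ∀ a, (f a).IsHermitian) (p : Polynomial ℝ) :
    Measurable fun a => ∑ i, p.eval ((hH a).eigenvalues i) := by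
  have : (fun a => ∑ i, p.eval ((hH a).eigenvalues i))
      = fun a => ∑ k ∈ p.support, p.coeff k * (f a ^ k).trace := by
    funext a
    simp only [Polynomial.eval_eq_sum, Polynomial.sum, trace_pow_eq_sum_eigenvalues_pow (hH a),
      Finset.mul_sum]
    rw [Finset.sum_comm]
  rw [this]
  refine Finset.measurable_fun_sum _ fun k _ => Measurable.const_mul ?_ _
  exact Finset.measurable_fun_sum _ fun i _ => measurable_matrix_pow hf k i i

/-- Weierstrass approximation on [-N, N] with error 1/(N + 1): for each fixed matrix all eigenvalues
eventually lie in the interval, so the polynomial sums converge pointwise. -/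
theorem measurable_sum_continuous_eigenvalues {f : α → Matrix ι ι ℝ}
    (hf : ∀ i j, Measurable fun a => f a i j) (hH : ∀ a, (f a).IsHermitian) {g : ℝ → ℝ}
    (hg : Continuous g) : Measurable fun a => ∑ i, g ((hH a).eigenvalues i) := by
  have hp : ∀ N : ℕ, ∃ p : Polynomial ℝ, ∀ x ∈ Set.Icc (-(N : ℝ)) N,
      |p.eval x - g x| < 1 / ((N : ℝ) + 1) := fun N =>
    exists_polynomial_near_of_continuousOn _ _ g hg.continuousOn _ (by positivity)
  choose p hp using hp
  refine measurable_of_tendsto_metrizable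
    (fun N => measurable_sum_polynomial_eigenvalues hf hH (p N)) ?_
  rw [tendsto_pi_nhds]
  intro a
  refine tendsto_finsetSum _ fun i _ => ?_
  rw [tendsto_iff_dist_tendsto_zero]
  refine squeeze_zero' (Eventually.of_forall fun _ => dist_nonneg) ?_
    tendsto_one_div_add_atTop_nhds_zero_nat
  obtain ⟨N, hN⟩ := exists_nat_ge |(hH a).eigenvalues i|
  filter_upwards [eventually_ge_atTop N] with M hM
  rw [Real.dist_eq]
  refine (hp M _ (abs_le.mp (hN.trans ?_))).le
  exact_mod_cast hM

theorem tendsto_ramp_indicator (x u : ℝ) :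
    Tendsto (fun N : ℕ => max 0 (min 1 (1 - N * (u - x)))) atTop
      (𝓝 (if u ≤ x then 1 else 0)) := by
  split_ifs with h
  · refine tendsto_const_nhds.congr fun N => ?_
    have : 0 ≤ (N : ℝ) * (x - u) := mul_nonneg (Nat.cast_nonneg _) (by linarith)
    rw [min_eq_left (by linarith), max_eq_right zero_le_one]
  · push Not at h
    refine tendsto_const_nhds.congr' ?_
    obtain ⟨N, hN⟩ := exists_nat_ge (1 / (u - x))
    filter_upwards [eventually_ge_atTop N] with M hM
    have h1 : 1 ≤ (N : ℝ) * (u - x) := (div_le_iff₀ (by linarith)).mp hN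
    have h2 : (N : ℝ) * (u - x) ≤ M * (u - x) :=
      mul_le_mul_of_nonneg_right (by exact_mod_cast hM) (by linarith)
    rw [max_eq_left]
    exact (min_le_right _ _).trans (by linarith)

theorem measurable_card_eigenvalues_le {f : α → Matrix ι ι ℝ}
    (hf : ∀ i j, Measurable fun a => f a i j) (hH : ∀ a, (f a).IsHermitian) (x : ℝ) :
    Measurable fun a => ((Finset.univ.filter fun i => (hH a).eigenvalues i ≤ x).card : ℝ) := by
  refine measurable_of_tendsto_metrizable (fun N : ℕ => measurable_sum_continuous_eigenvalues hf hH
    (g := fun u => max 0 (min 1 (1 - N * (u - x)))) (by fun_prop)) ?_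
  rw [tendsto_pi_nhds]
  intro a
  have : ((Finset.univ.filter fun i => (hH a).eigenvalues i ≤ x).card : ℝ)
      = ∑ i, if (hH a).eigenvalues i ≤ x then (1 : ℝ) else 0 := by simp
  rw [this]
  exact tendsto_finsetSum _ fun i _ => tendsto_ramp_indicator x _

/-- For a decreasing list, the k-th term is at most x exactly when it and the later terms, N - k in
number, are. This recovers each eigenvalue from the counting function. -/
theorem antitone_le_iff_card {N : ℕ} {g : Fin N → ℝ} (hg : Antitone g) (k : Fin N) (x : ℝ) :
    g k ≤ x ↔ N - k ≤ (Finset.univ.filter fun j => g j ≤ x).card := by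
  constructor
  · intro h
    rw [← Fin.card_Ici]
    refine Finset.card_le_card fun j hj => ?_
    simp only [Finset.mem_filter, Finset.mem_univ, true_and]
    exact (hg (Finset.mem_Ici.mp hj)).trans h
  · intro h
    by_contra hk
    have : (Finset.univ.filter fun j => g j ≤ x).card ≤ (Finset.Ioi k).card := by
      refine Finset.card_le_card fun j hj => ?_
      simp only [Finset.mem_filter, Finset.mem_univ, true_and] at hj
      rw [Finset.mem_Ioi]
      by_contra hjk
      exact hk ((hg (not_lt.mp hjk)).trans hj)
    rw [Fin.card_Ioi] at this
    have := k.2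
    omega

theorem measurable_eigenvalues {f : α → Matrix ι ι ℝ}
    (hf : ∀ i j, Measurable fun a => f a i j) (hH : ∀ a, (f a).IsHermitian) (i : ι) :
    Measurable fun a => (hH a).eigenvalues i := by
  refine measurable_of_Iic fun x => ?_
  let e : Fin (Fintype.card ι) ≃ ι := Fintype.equivOfCardEq (Fintype.card_fin _)
  have hset : (fun a => (hH a).eigenvalues i) ⁻¹' Set.Iic x
      = (fun a => ((Finset.univ.filter fun i => (hH a).eigenvalues i ≤ x).card : ℝ)) ⁻¹'
        Set.Ici ((Fintype.card ι - (e.symm i : ℕ) : ℕ) : ℝ) := by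
    ext a
    simp only [Set.mem_preimage, Set.mem_Iic, Set.mem_Ici, Nat.cast_le]
    have hc : (Finset.univ.filter fun i => (hH a).eigenvalues i ≤ x).card
        = (Finset.univ.filter fun j => (hH a).eigenvalues₀ j ≤ x).card := by
      rw [← Finset.card_map e.symm.toEmbedding]
      congr 1
      ext j
      have hj : (hH a).eigenvalues (e j) = (hH a).eigenvalues₀ j :=
        congrArg (hH a).eigenvalues₀ (e.symm_apply_apply j)
      rw [Finset.mem_map_equiv, Equiv.symm_symm, Finset.mem_filter, Finset.mem_filter, hj]
      simp
    rw [hc]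
    exact antitone_le_iff_card (hH a).eigenvalues₀_antitone (e.symm i) x
  rw [hset]
  exact measurable_card_eigenvalues_le hf hH x measurableSet_Ici

end Eigenvalues

/-! ### The expected empirical spectral measure. -/

section SpectralMeasure

variable {Ω : Type*} [MeasurableSpace Ω] {P : Measure Ω} {n : ℕ}
  {X : Ω → Matrix (Fin n) (Fin n) ℝ}

theorem aemeasurable_eigenvalues (hm : ∀ i j, AEMeasurable (fun ω => X ω i j) P)
    (hH : ∀ ω, (X ω).IsHermitian) (i : Fin n) :
    AEMeasurable (fun ω => (hH ω).eigenvalues i) P := by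
  have h1 : AEMeasurable (fun ω (p : Fin n × Fin n) => X ω p.1 p.2) P :=
    aemeasurable_pi_lambda _ fun p => hm p.1 p.2
  -- Reading entries through `min` and `max` makes `N y` Hermitian for every y, so its eigenvalues
  -- are defined on the whole space and not only on the range of `X`.
  let N : (Fin n × Fin n → ℝ) → Matrix (Fin n) (Fin n) ℝ :=
    fun y => Matrix.of fun j k => y (min j k, max j k)
  have hNH : ∀ y, (N y).IsHermitian := by
    intro y
    ext j k
    simp [N, Matrix.conjTranspose_apply, min_comm, max_comm]
  have hN : ∀ ω, N (fun p => X ω p.1 p.2) = X ω := by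
    intro ω
    ext j k
    have := congrFun (congrFun (hH ω) j) k
    simp only [Matrix.conjTranspose_apply, star_trivial] at this
    simp only [N, Matrix.of_apply]
    rcases le_total j k with h | h <;> simp [h, this]
  have h2 := (measurable_eigenvalues (f := N)
    (fun j k => measurable_pi_apply (min j k, max j k)) hNH i).comp_aemeasurable h1
  refine h2.congr (Eventually.of_forall fun ω => ?_)
  simp only [Function.comp_apply, hN]

/-- The expectation of the empirical spectral measure of a random Hermitian matrix. -/
noncomputable def meanSpectralMeasure (P : Measure Ω) (hH : ∀ ω, (X ω).IsHermitian) : Measure ℝ :=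
  (n : ENNReal)⁻¹ • ∑ i, P.map fun ω => (hH ω).eigenvalues i

theorem isProbabilityMeasure_meanSpectralMeasure [IsProbabilityMeasure P] (hn : n ≠ 0)
    (hm : ∀ i j, AEMeasurable (fun ω => X ω i j) P) (hH : ∀ ω, (X ω).IsHermitian) :
    IsProbabilityMeasure (meanSpectralMeasure P hH) := by
  constructor
  have : ∀ i : Fin n, (P.map fun ω => (hH ω).eigenvalues i) Set.univ = 1 := fun i => by
    rw [Measure.map_apply_of_aemeasurable (aemeasurable_eigenvalues hm hH i) MeasurableSet.univ]
    simp
  simp only [meanSpectralMeasure, Measure.smul_apply, Measure.finsetSum_apply, this,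
    Finset.sum_const, Finset.card_univ, Fintype.card_fin, smul_eq_mul, nsmul_eq_mul, mul_one]
  exact ENNReal.inv_mul_cancel (by exact_mod_cast hn) (ENNReal.natCast_ne_top n)

theorem integral_meanSpectralMeasure [IsProbabilityMeasure P] {E : Type*} [NormedAddCommGroup E]
    [NormedSpace ℝ E]
    (hm : ∀ i j, AEMeasurable (fun ω => X ω i j) P) (hH : ∀ ω, (X ω).IsHermitian) {f : ℝ → E}
    (hf : StronglyMeasurable f) {C : ℝ} (hC : ∀ x, ‖f x‖ ≤ C) :
    ∫ x, f x ∂meanSpectralMeasure P hH = (n : ℝ)⁻¹ • ∫ ω, ∑ i, f ((hH ω).eigenvalues i) ∂P := by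
  have hae := aemeasurable_eigenvalues hm hH
  have hI : ∀ i, Integrable (fun ω => f ((hH ω).eigenvalues i)) P := fun i =>
    Integrable.of_bound (hf.aestronglyMeasurable.comp_aemeasurable (hae i)) C
      (Eventually.of_forall fun ω => hC _)
  have hI' : ∀ i, Integrable f (P.map fun ω => (hH ω).eigenvalues i) := fun i =>
    (integrable_map_measure hf.aestronglyMeasurable (hae i)).mpr (hI i)
  rw [meanSpectralMeasure, integral_smul_measure, integral_finsetSum_measure fun i _ => hI' i,
    integral_finsetSum _ fun i _ => hI i]
  simp only [ENNReal.toReal_inv, ENNReal.toReal_natCast]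
  congr 1
  exact Finset.sum_congr rfl fun i _ => integral_map (hae i) hf.aestronglyMeasurable

theorem meanSpectralMeasure_real_Iic [IsProbabilityMeasure P]
    (hm : ∀ i j, AEMeasurable (fun ω => X ω i j) P) (hH : ∀ ω, (X ω).IsHermitian) (x : ℝ) :
    (meanSpectralMeasure P hH).real (Set.Iic x) = ∫ ω, spectralCDF (hH ω) x ∂P := by
  have h := integral_meanSpectralMeasure hm hH (f := Set.indicator (Set.Iic x) (fun _ => (1 : ℝ)))
    (stronglyMeasurable_const.indicator measurableSet_Iic) (C := 1) (fun u => by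
      by_cases hu : u ∈ Set.Iic x <;> simp [hu])
  rw [integral_indicator measurableSet_Iic, setIntegral_const, smul_eq_mul, mul_one] at h
  rw [h, smul_eq_mul, ← integral_const_mul]
  refine integral_congr_ae (Eventually.of_forall fun ω => ?_)
  simp only [spectralCDF, Set.indicator_apply, Set.mem_Iic, Finset.sum_boole]
  rw [div_eq_inv_mul]

end SpectralMeasure

/-! ### The semicircle law and its Stieltjes transform. -/

/-- The semicircle law as a measure on the real line. -/
noncomputable def semicircleMeasure : Measure ℝ :=
  volume.withDensity fun x => ENNReal.ofReal (semicircleDensity x)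

theorem semicircleDensity_nonneg (x : ℝ) : 0 ≤ semicircleDensity x :=
  Set.indicator_nonneg (fun _ _ => by positivity) x

theorem setOf_abs_le_two : {u : ℝ | |u| ≤ 2} = Set.Icc (-2) 2 := by
  ext u; simp [abs_le]

theorem measurable_semicircleDensity : Measurable semicircleDensity := by
  unfold semicircleDensity
  rw [setOf_abs_le_two]
  exact Measurable.indicator (by fun_prop) measurableSet_Icc

theorem integral_semicircleMeasure (g : ℝ → ℂ) :
    ∫ u, g u ∂semicircleMeasure
      = ∫ u in (-2 : ℝ)..2, (1 / (2 * Real.pi) * Real.sqrt (4 - u ^ 2)) • g u := by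
  rw [semicircleMeasure, integral_withDensity_eq_integral_toReal_smul
    (measurable_semicircleDensity.ennreal_ofReal) (by simp)]
  simp only [ENNReal.toReal_ofReal (semicircleDensity_nonneg _)]
  rw [intervalIntegral.integral_of_le (by norm_num), ← integral_Icc_eq_integral_Ioc,
    ← integral_indicator measurableSet_Icc]
  congr 1
  funext u
  rw [semicircleDensity, setOf_abs_le_two, Set.indicator_smul_apply_left]

/-- The substitution u = 2 cos θ, under which the square root becomes 2 sin θ on [0, π]. -/
theorem integral_semicircleMeasure_eq_trig {g : ℝ → ℂ} (hg : Continuous g) :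
    ∫ u, g u ∂semicircleMeasure
      = ∫ θ in (0 : ℝ)..Real.pi, (2 / Real.pi * Real.sin θ ^ 2) • g (2 * Real.cos θ) := by
  have h := intervalIntegral.integral_deriv_smul_comp (a := 0) (b := Real.pi)
    (f := fun θ => 2 * Real.cos θ) (f' := fun θ => 2 * (-Real.sin θ))
    (g := fun u => (1 / (2 * Real.pi) * Real.sqrt (4 - u ^ 2)) • g u)
    (fun x _ => (Real.hasDerivAt_cos x).const_mul 2) (by fun_prop) (by fun_prop)
  rw [integral_semicircleMeasure, intervalIntegral.integral_symm]
  simp only [Real.cos_zero, Real.cos_pi, mul_one, mul_neg] at h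
  rw [← h, ← intervalIntegral.integral_neg]
  refine intervalIntegral.integral_congr fun θ hθ => ?_
  rw [Set.uIcc_of_le Real.pi_pos.le] at hθ
  have hs : 0 ≤ Real.sin θ := Real.sin_nonneg_of_mem_Icc hθ
  have hsq : Real.sqrt (4 - (2 * Real.cos θ) ^ 2) = 2 * Real.sin θ := by
    rw [show 4 - (2 * Real.cos θ) ^ 2 = (2 * Real.sin θ) ^ 2 by
      have := Real.sin_sq_add_cos_sq θ; nlinarith]
    exact Real.sqrt_sq (by linarith)
  simp only [Function.comp_apply, hsq, smul_smul, ← neg_smul]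
  congr 1
  field_simp

/-- The values of A at e^{iθ} and e^{-iθ} for θ in [0, π] together sweep the unit circle, so the
mean value property of holomorphic functions evaluates the integral. -/
theorem integral_semicircleMeasure_of_eq_add {g : ℝ → ℂ} (hg : Continuous g) {A : ℂ → ℂ}
    (hA : DiffContOnCl ℂ A (Metric.ball 0 1))
    (h : ∀ θ : ℝ, 2 * (Real.sin θ : ℂ) ^ 2 * g (2 * Real.cos θ)
      = A (Complex.exp (θ * Complex.I)) + A (Complex.exp (-θ * Complex.I))) :
    ∫ u, g u ∂semicircleMeasure = 2 * A 0 := by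
  have hAc : Continuous fun θ : ℝ => A (Complex.exp (θ * Complex.I)) := by
    have h1 : ContinuousOn A (Metric.closedBall 0 1) := by
      rw [← closure_ball (0 : ℂ) one_ne_zero]; exact hA.continuousOn
    refine h1.comp_continuous (by fun_prop) fun θ => ?_
    simp [Complex.norm_exp_ofReal_mul_I]
  have hAc' : Continuous fun θ : ℝ => A (Complex.exp (-θ * Complex.I)) := by
    have := hAc.comp continuous_neg
    simpa [Function.comp_def] using this
  have hav := DiffContOnCl.circleAverage (f := A) (c := 0) (R := 1) (by simpa using hA)
  rw [Real.circleAverage_def] at hav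
  simp only [circleMap, Complex.ofReal_one, one_mul, zero_add] at hav
  have hper : ∫ θ in (0 : ℝ)..2 * Real.pi, A (Complex.exp (θ * Complex.I))
      = ∫ θ in -Real.pi..Real.pi, A (Complex.exp (θ * Complex.I)) := by
    have hp : Function.Periodic (fun θ : ℝ => A (Complex.exp (θ * Complex.I))) (2 * Real.pi) := by
      intro θ
      simp only
      congr 1
      push_cast
      rw [add_mul, Complex.exp_periodic]
    have := hp.intervalIntegral_add_eq 0 (-Real.pi)
    rw [zero_add] at this
    rw [this]
    congr 1
    ring
  rw [hper, ← intervalIntegral.integral_add_adjacent_intervals (b := 0)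
    (hAc.intervalIntegrable _ _) (hAc.intervalIntegrable _ _)] at hav
  have hneg : ∫ θ in -Real.pi..0, A (Complex.exp (θ * Complex.I))
      = ∫ θ in (0 : ℝ)..Real.pi, A (Complex.exp (-θ * Complex.I)) := by
    have := intervalIntegral.integral_comp_neg (a := 0) (b := Real.pi)
      (fun θ : ℝ => A (Complex.exp (θ * Complex.I)))
    rw [neg_zero] at this
    rw [← this]
    simp
  rw [hneg, add_comm, ← intervalIntegral.integral_add (hAc.intervalIntegrable _ _)
    (hAc'.intervalIntegrable _ _)] at hav
  rw [integral_semicircleMeasure_eq_trig hg, ← hav, Complex.real_smul, ← mul_assoc,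
    ← intervalIntegral.integral_const_mul]
  refine intervalIntegral.integral_congr fun θ _ => ?_
  rw [← h, Complex.real_smul]
  have : (Real.pi : ℂ) ≠ 0 := by exact_mod_cast Real.pi_ne_zero
  push_cast
  field_simp

instance isProbabilityMeasure_semicircleMeasure : IsProbabilityMeasure semicircleMeasure := by
  -- From 2 sin² θ = 1 - cos 2θ, split evenly between e^{iθ} and e^{-iθ}; the total mass is 2 ·
  -- (1/2).
  have hA : DiffContOnCl ℂ (fun w : ℂ => (1 - w ^ 2) / 2) (Metric.ball 0 1) :=
    Differentiable.diffContOnCl (by fun_prop)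
  have h := integral_semicircleMeasure_of_eq_add (g := fun _ => 1) continuous_const hA (by
    intro θ
    have e1 : Complex.exp (θ * Complex.I) ^ 2 + Complex.exp (-θ * Complex.I) ^ 2
        = 2 * Complex.cos (2 * θ) := by
      rw [Complex.cos, ← Complex.exp_nat_mul, ← Complex.exp_nat_mul]
      push_cast
      ring_nf
    have e2 := Complex.cos_sq' (θ : ℂ)
    rw [Complex.cos_two_mul] at e1
    push_cast
    linear_combination (1 / 2) * e1 + 2 * e2)
  have hfin : semicircleMeasure.real Set.univ = 1 := by
    have h' : ((semicircleMeasure.real Set.univ : ℝ) : ℂ) = 1 := by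
      simpa using h
    exact_mod_cast h'
  exact ⟨by rwa [measureReal_def, ENNReal.toReal_eq_one_iff] at hfin⟩

/-- The two roots have product 1 and sum -z. If both had modulus 1 they would be conjugate and z
would be real, so one lies strictly inside the disc. -/
theorem exists_root_norm_lt_one {z : ℂ} (hz : 0 < z.im) :
    ∃ m : ℂ, ‖m‖ < 1 ∧ m * (-z - m) = 1 := by
  obtain ⟨s, hs⟩ := IsAlgClosed.exists_pow_nat_eq (z ^ 2 - 4) (n := 2) (by norm_num)
  set a := (-z + s) / 2 with ha
  set b := (-z - s) / 2 with hb
  have hra : a * (-z - a) = 1 := by rw [ha]; linear_combination (-1 / 4) * hs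
  have hrb : b * (-z - b) = 1 := by rw [hb]; linear_combination (-1 / 4) * hs
  have hab : a * b = 1 := by rw [ha, hb]; linear_combination (-1 / 4) * hs
  have hn : ‖a‖ * ‖b‖ = 1 := by rw [← norm_mul, hab, norm_one]
  rcases lt_trichotomy ‖a‖ 1 with h | h | h
  · exact ⟨a, h, hra⟩
  · exfalso
    have hc : a * (starRingEnd ℂ) a = 1 := by rw [Complex.mul_conj', h]; simp
    have ha0 : a ≠ 0 := by rintro h0; simp [h0] at hab
    have hbc : b = (starRingEnd ℂ) a := mul_left_cancel₀ ha0 (hab.trans hc.symm)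
    have hsum : z = -(a + b) := by rw [ha, hb]; ring
    rw [hsum, hbc] at hz
    simp at hz
  · refine ⟨b, ?_, hrb⟩
    by_contra hb1
    push Not at hb1
    nlinarith

theorem ofReal_sub_ne_zero {z : ℂ} (hz : 0 < z.im) (u : ℝ) : (u : ℂ) - z ≠ 0 := by
  intro h
  have := congrArg Complex.im h
  simp at this
  exact hz.ne' this

theorem norm_inv_ofReal_sub_le {z : ℂ} (hz : 0 < z.im) (u : ℝ) :
    ‖((u : ℂ) - z)⁻¹‖ ≤ 1 / z.im := by
  rw [norm_inv, ← one_div]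
  refine one_div_le_one_div_of_le hz ?_
  have := Complex.abs_im_le_norm ((u : ℂ) - z)
  simp only [Complex.sub_im, Complex.ofReal_im, zero_sub, abs_neg] at this
  exact (le_abs_self _).trans this

theorem continuous_inv_ofReal_sub {z : ℂ} (hz : 0 < z.im) :
    Continuous fun u : ℝ => ((u : ℂ) - z)⁻¹ :=
  Continuous.inv₀ (by fun_prop) (ofReal_sub_ne_zero hz)

/-- The Stieltjes transform of the semicircle law. -/
theorem stieltjes_semicircleMeasure {z : ℂ} (hz : 0 < z.im) :
    (∫ u : ℝ, ((u : ℂ) - z)⁻¹ ∂semicircleMeasure)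
        * (-z - ∫ u : ℝ, ((u : ℂ) - z)⁻¹ ∂semicircleMeasure) = 1 ∧
      ‖∫ u : ℝ, ((u : ℂ) - z)⁻¹ ∂semicircleMeasure‖ ≤ 1 / z.im := by
  obtain ⟨m, hm1, hm⟩ := exists_root_norm_lt_one hz
  have hne : ∀ w : ℂ, ‖w‖ ≤ 1 → 1 + m * w ≠ 0 := by
    intro w hw h0
    have h1 : m * w = -1 := by linear_combination h0
    have h2 : ‖m‖ * ‖w‖ = 1 := by rw [← norm_mul, h1]; simp
    nlinarith [norm_nonneg m, norm_nonneg w]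
  -- With z = -(m + 1/m) and w = e^{iθ}, one has 2 cos θ - z = (1 + mw)(1 + m/w) / m. Decomposing 2
  -- sin² θ / (2 cos θ - z) into parts in w and 1/w gives this function. Its only possible pole,
  -- -1/m, lies outside the closed disc since |m| < 1, and twice its value at 0 is m.
  have hA : DiffContOnCl ℂ (fun w : ℂ => m / 2 * (1 - w ^ 2) / (1 + m * w)) (Metric.ball 0 1) := by
    have hd : DifferentiableOn ℂ (fun w : ℂ => m / 2 * (1 - w ^ 2) / (1 + m * w))
        (closure (Metric.ball 0 1)) := by
      rw [closure_ball (0 : ℂ) one_ne_zero]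
      refine DifferentiableOn.div (by fun_prop) (by fun_prop) fun w hw => hne w ?_
      simpa using hw
    exact hd.diffContOnCl
  have h := integral_semicircleMeasure_of_eq_add (continuous_inv_ofReal_sub hz) hA (by
    intro θ
    set w := Complex.exp (θ * Complex.I) with hw
    have hinv : Complex.exp (-θ * Complex.I) = w⁻¹ := by rw [hw, ← Complex.exp_neg]; ring_nf
    have hw1 : ‖w‖ = 1 := Complex.norm_exp_ofReal_mul_I θ
    have hw0 : w ≠ 0 := Complex.exp_ne_zero _
    have hm0 : m ≠ 0 := by rintro rfl; simp at hm
    have hzm : z = -(m + m⁻¹) := by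
      field_simp
      linear_combination -hm
    have hcos : (Real.cos θ : ℂ) = (w + w⁻¹) / 2 := by
      rw [← hinv, Complex.ofReal_cos, Complex.cos]
    have hsin : (Real.sin θ : ℂ) ^ 2 = -(w - w⁻¹) ^ 2 / 4 := by
      have := Complex.sin_sq_add_cos_sq (θ : ℂ)
      rw [Complex.ofReal_sin]
      rw [Complex.ofReal_cos] at hcos
      rw [hcos] at this
      have hww : w * w⁻¹ = 1 := mul_inv_cancel₀ hw0
      linear_combination this - hww
    have n1 : 1 + m * w ≠ 0 := hne w hw1.le
    have n2 : 1 + m * w⁻¹ ≠ 0 := hne _ (by rw [norm_inv, hw1, inv_one])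
    have n3 : w + m ≠ 0 := by
      intro h0
      apply n2
      field_simp
      rw [h0, mul_zero]
    rw [hinv, hsin]
    push_cast
    rw [← Complex.ofReal_cos, hcos]
    have e3 : 2 * ((w + w⁻¹) / 2) - z = (1 + m * w) * (w + m) / (m * w) := by
      rw [hzm]; field_simp; ring
    rw [e3]
    have e4 : 1 + m * w⁻¹ = (w + m) / w := by field_simp
    have n4 : 1 + w * m ≠ 0 := by rwa [mul_comm w m]
    rw [e4]
    field_simp
    ring)
  have hS : ∫ u : ℝ, ((u : ℂ) - z)⁻¹ ∂semicircleMeasure = m := by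
    rw [h]; simp; ring
  refine ⟨by rw [hS]; exact hm, ?_⟩
  have := norm_integral_le_of_norm_le_const (μ := semicircleMeasure)
    (Eventually.of_forall (norm_inv_ofReal_sub_le hz))
  simpa using this

theorem semicircleCDF_eq (x : ℝ) : semicircleCDF x = semicircleMeasure.real (Set.Iic x) := by
  rw [semicircleCDF, measureReal_def, semicircleMeasure, withDensity_apply _ measurableSet_Iic,
    integral_eq_lintegral_of_nonneg_ae (Eventually.of_forall semicircleDensity_nonneg)
      measurable_semicircleDensity.aestronglyMeasurable]

theorem semicircleMeasure_singleton (x : ℝ) : semicircleMeasure {x} = 0 :=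
  withDensity_absolutelyContinuous _ _ (by simp)

/-! ### Smoothing by the Cauchy law and its Fourier transform. -/

section Cauchy

open FourierTransform

theorem fourier_exp_neg_abs {η : ℝ} (hη : 0 < η) :
    Integrable (fun s : ℝ => Complex.exp (-(2 * Real.pi * η * |s| : ℝ))) ∧
    ∀ w : ℝ, 𝓕 (fun s : ℝ => Complex.exp (-(2 * Real.pi * η * |s| : ℝ))) w
      = ((Real.pi⁻¹ * η * (w ^ 2 + η ^ 2)⁻¹ : ℝ) : ℂ) := by
  have hpi := Real.pi_pos
  have key : ∀ w : ℝ,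
      Integrable (fun s : ℝ => Complex.exp (↑(-2 * Real.pi * s * w) * Complex.I)
        • Complex.exp (-(2 * Real.pi * η * |s| : ℝ))) ∧
      ∫ s : ℝ, Complex.exp (↑(-2 * Real.pi * s * w) * Complex.I)
        • Complex.exp (-(2 * Real.pi * η * |s| : ℝ))
      = ((Real.pi⁻¹ * η * (w ^ 2 + η ^ 2)⁻¹ : ℝ) : ℂ) := by
    intro w
    set a : ℂ := -2 * Real.pi * (η + w * Complex.I) with ha
    set b : ℂ := 2 * Real.pi * (η - w * Complex.I) with hb
    have har : a.re < 0 := by simp [ha]; positivity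
    have hbr : 0 < b.re := by simp [hb]; positivity
    have e1 : Set.EqOn (fun s : ℝ => Complex.exp (↑(-2 * Real.pi * s * w) * Complex.I)
        • Complex.exp (-(2 * Real.pi * η * |s| : ℝ))) (fun s : ℝ => Complex.exp (a * s))
        (Set.Ioi 0) := by
      intro s hs
      simp only [smul_eq_mul]
      rw [abs_of_pos hs, ← Complex.exp_add, ha]
      congr 1
      push_cast
      ring
    have e2 : Set.EqOn (fun s : ℝ => Complex.exp (↑(-2 * Real.pi * s * w) * Complex.I)
        • Complex.exp (-(2 * Real.pi * η * |s| : ℝ))) (fun s : ℝ => Complex.exp (b * s))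
        (Set.Iic 0) := by
      intro s hs
      simp only [smul_eq_mul]
      rw [abs_of_nonpos hs, ← Complex.exp_add, hb]
      congr 1
      push_cast
      ring
    have i1 := (integrableOn_exp_mul_complex_Ioi har 0).congr_fun e1.symm measurableSet_Ioi
    have i2 := (integrableOn_exp_mul_complex_Iic hbr 0).congr_fun e2.symm measurableSet_Iic
    refine ⟨?_, ?_⟩
    · rw [← integrableOn_univ, ← Set.Iic_union_Ioi (a := (0 : ℝ))]
      exact i2.union i1
    rw [← intervalIntegral.integral_Iic_add_Ioi i2 i1, setIntegral_congr_fun measurableSet_Iic e2,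
      setIntegral_congr_fun measurableSet_Ioi e1, integral_exp_mul_complex_Ioi har,
      integral_exp_mul_complex_Iic hbr]
    simp only [Complex.ofReal_zero, mul_zero, Complex.exp_zero]
    have h1 : (η : ℂ) + w * Complex.I ≠ 0 := by
      intro h
      have := congrArg Complex.re h
      simp at this
      exact hη.ne' this
    have h2 : (η : ℂ) - w * Complex.I ≠ 0 := by
      intro h
      have := congrArg Complex.re h
      simp at this
      exact hη.ne' this
    have h3 : (w : ℂ) ^ 2 + (η : ℂ) ^ 2 = (η + w * Complex.I) * (η - w * Complex.I) := by
      linear_combination ((w : ℂ) ^ 2) * Complex.I_sq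
    have h4 : (Real.pi : ℂ) ≠ 0 := by exact_mod_cast hpi.ne'
    push_cast
    rw [h3, ha, hb]
    field_simp
    ring
  refine ⟨?_, fun w => ?_⟩
  · simpa using (key 0).1
  · rw [Real.fourier_real_eq_integral_exp_smul]
    exact (key w).2

/-- By Fourier inversion the integral is exp(-η|t|). Non-vanishing is what makes convolution with
the Cauchy law invertible on characteristic functions. -/
theorem integral_exp_mul_cauchy_ne_zero {η : ℝ} (hη : 0 < η) (t : ℝ) :
    ∫ x : ℝ, Complex.exp (t * x * Complex.I)
      * ((Real.pi⁻¹ * η * (x ^ 2 + η ^ 2)⁻¹ : ℝ) : ℂ) ≠ 0 := by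
  obtain ⟨hint, hF⟩ := fourier_exp_neg_abs hη
  have hF' : 𝓕 (fun s : ℝ => Complex.exp (-(2 * Real.pi * η * |s| : ℝ)))
      = fun w : ℝ => ((Real.pi⁻¹ * η * (w ^ 2 + η ^ 2)⁻¹ : ℝ) : ℂ) := funext hF
  have hc : Integrable (fun w : ℝ => Real.pi⁻¹ * η * (w ^ 2 + η ^ 2)⁻¹) := by
    have := integrable_cauchyPDFReal 0 (γ := ⟨η, hη.le⟩)
    simp only [funext (cauchyPDFReal_def 0 ⟨η, hη.le⟩), sub_zero] at this
    exact this
  have hinv := Continuous.fourierInv_fourier_eq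
    (f := fun s : ℝ => Complex.exp (-(2 * Real.pi * η * |s| : ℝ)))
    (by fun_prop) hint (by rw [hF']; exact hc.ofReal)
  have h := congrFun hinv (t / (2 * Real.pi))
  rw [hF', Real.fourierInv_eq'] at h
  have e : ∀ x : ℝ, Complex.exp (t * x * Complex.I) * ((Real.pi⁻¹ * η * (x ^ 2 + η ^ 2)⁻¹ : ℝ) : ℂ)
      = Complex.exp (↑(2 * Real.pi * inner ℝ x (t / (2 * Real.pi))) * Complex.I)
        • ((Real.pi⁻¹ * η * (x ^ 2 + η ^ 2)⁻¹ : ℝ) : ℂ) := by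
    intro x
    rw [smul_eq_mul]
    congr 3
    have h4 : (Real.pi : ℂ) ≠ 0 := by exact_mod_cast Real.pi_ne_zero
    rw [RCLike.inner_apply, conj_trivial]
    push_cast
    field_simp
  simp only [e]
  rw [h]
  exact Complex.exp_ne_zero _

/-- The density of the convolution of `μ` with the Cauchy law of scale `η`. -/
noncomputable def cauchySmoothing (μ : Measure ℝ) (η x : ℝ) : ℝ :=
  ∫ u, Real.pi⁻¹ * η * ((x - u) ^ 2 + η ^ 2)⁻¹ ∂μ

variable {μ : Measure ℝ} [IsProbabilityMeasure μ] {η : ℝ}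

/-- The Poisson kernel: Im 1/(u - x - iη) = η / ((x - u)² + η²). -/
theorem cauchySmoothing_eq (hη : 0 < η) (x : ℝ) :
    cauchySmoothing μ η x
      = Real.pi⁻¹ * (∫ u : ℝ, ((u : ℂ) - (x + η * Complex.I))⁻¹ ∂μ).im := by
  have hz : 0 < ((x : ℂ) + η * Complex.I).im := by simpa using hη
  have hint : Integrable (fun u : ℝ => ((u : ℂ) - (x + η * Complex.I))⁻¹) μ :=
    Integrable.of_bound (continuous_inv_ofReal_sub hz).aestronglyMeasurable _
      (Eventually.of_forall (norm_inv_ofReal_sub_le hz))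
  have him : (∫ u : ℝ, ((u : ℂ) - (x + η * Complex.I))⁻¹ ∂μ).im
      = ∫ u : ℝ, (((u : ℂ) - (x + η * Complex.I))⁻¹).im ∂μ := (integral_im hint).symm
  rw [him, ← integral_const_mul, cauchySmoothing]
  congr 1
  funext u
  rw [Complex.inv_im, Complex.normSq_apply]
  simp
  ring

theorem integrable_cauchyKernel (hη : 0 < η) (u : ℝ) :
    Integrable (fun x : ℝ => Real.pi⁻¹ * η * ((x - u) ^ 2 + η ^ 2)⁻¹) ∧
    ∫ x : ℝ, Real.pi⁻¹ * η * ((x - u) ^ 2 + η ^ 2)⁻¹ = 1 := by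
  have h1 := integrable_cauchyPDFReal u (γ := ⟨η, hη.le⟩)
  have h2 := integral_cauchyPDFReal_eq_one u (γ := ⟨η, hη.le⟩)
    (by intro h; exact hη.ne' (congrArg NNReal.toReal h))
  have e := funext (cauchyPDFReal_def u ⟨η, hη.le⟩)
  rw [e] at h1 h2
  exact ⟨h1, h2⟩

theorem integrable_cauchyKernel_prod (hη : 0 < η) :
    Integrable (fun p : ℝ × ℝ => Real.pi⁻¹ * η * ((p.2 - p.1) ^ 2 + η ^ 2)⁻¹) (μ.prod volume) := by
  have hm : AEStronglyMeasurable
      (fun p : ℝ × ℝ => Real.pi⁻¹ * η * ((p.2 - p.1) ^ 2 + η ^ 2)⁻¹) (μ.prod volume) := by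
    have : Measurable (fun p : ℝ × ℝ => Real.pi⁻¹ * η * ((p.2 - p.1) ^ 2 + η ^ 2)⁻¹) := by
      fun_prop
    exact this.aestronglyMeasurable
  rw [integrable_prod_iff hm]
  refine ⟨Eventually.of_forall fun u => (integrable_cauchyKernel hη u).1, ?_⟩
  have : ∀ u x : ℝ, ‖Real.pi⁻¹ * η * ((x - u) ^ 2 + η ^ 2)⁻¹‖
      = Real.pi⁻¹ * η * ((x - u) ^ 2 + η ^ 2)⁻¹ := fun u x =>
    Real.norm_of_nonneg (by have := Real.pi_pos; positivity)
  simp only [this, (integrable_cauchyKernel hη _).2]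
  exact integrable_const _

theorem integrable_cauchySmoothing (hη : 0 < η) : Integrable (cauchySmoothing μ η) :=
  (integrable_cauchyKernel_prod hη).integral_prod_right

omit [IsProbabilityMeasure μ] in
theorem cauchySmoothing_nonneg (hη : 0 < η) (x : ℝ) : 0 ≤ cauchySmoothing μ η x :=
  integral_nonneg fun u => by have := Real.pi_pos; positivity

theorem integral_cauchySmoothing (hη : 0 < η) : ∫ x, cauchySmoothing μ η x = 1 := by
  unfold cauchySmoothing
  rw [integral_integral_swap]
  · simp [(integrable_cauchyKernel hη _).2]
  · exact (integrable_cauchyKernel_prod hη).swap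

/-- The Fourier transform of a convolution is a product, by Fubini and the translation x ↦ x + u. -/
theorem integral_exp_mul_cauchySmoothing (hη : 0 < η) (t : ℝ) :
    ∫ x : ℝ, Complex.exp (t * x * Complex.I) * cauchySmoothing μ η x
      = charFun μ t * ∫ x : ℝ, Complex.exp (t * x * Complex.I)
          * ((Real.pi⁻¹ * η * (x ^ 2 + η ^ 2)⁻¹ : ℝ) : ℂ) := by
  have hswap : Integrable (fun p : ℝ × ℝ => Complex.exp (t * p.1 * Complex.I)
      * ((Real.pi⁻¹ * η * ((p.1 - p.2) ^ 2 + η ^ 2)⁻¹ : ℝ) : ℂ)) (volume.prod μ) := by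
    refine Integrable.bdd_mul (c := 1) (integrable_cauchyKernel_prod hη).swap.ofReal ?_
      (Eventually.of_forall fun p => ?_)
    · have : Measurable fun p : ℝ × ℝ => Complex.exp (t * p.1 * Complex.I) := by fun_prop
      exact this.aestronglyMeasurable
    · rw [← Complex.ofReal_mul, Complex.norm_exp_ofReal_mul_I]
  have e1 : ∀ x : ℝ, Complex.exp (t * x * Complex.I) * cauchySmoothing μ η x
      = ∫ u : ℝ, Complex.exp (t * x * Complex.I)
        * ((Real.pi⁻¹ * η * ((x - u) ^ 2 + η ^ 2)⁻¹ : ℝ) : ℂ) ∂μ := by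
    intro x
    rw [integral_const_mul, cauchySmoothing, integral_complex_ofReal]
  simp only [e1]
  rw [integral_integral_swap hswap, charFun_apply_real, ← integral_mul_const]
  congr 1
  funext u
  rw [← integral_const_mul, ← integral_add_right_eq_self _ u]
  congr 1
  funext x
  rw [add_sub_cancel_right, ← mul_assoc, ← Complex.exp_add]
  congr 2
  push_cast
  ring

end Cauchy

/-! ### From Stieltjes transforms to weak convergence, and from pointwise to uniform convergence. -/

/-- **Scheffé's lemma**, tested against a bounded function. -/
theorem tendsto_integral_mul_of_tendsto_density {α : Type*} [MeasurableSpace α] {ν : Measure α}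
    {p : ℕ → α → ℝ} {q : α → ℝ} (hp : ∀ᶠ n in atTop, Integrable (p n) ν ∧ (∀ x, 0 ≤ p n x) ∧
      ∫ x, p n x ∂ν = ∫ x, q x ∂ν) (hq : Integrable q ν) (hq0 : ∀ x, 0 ≤ q x)
    (hlim : ∀ x, Tendsto (fun n => p n x) atTop (𝓝 (q x))) {g : α → ℂ}
    (hg : AEStronglyMeasurable g ν) (hg1 : ∀ x, ‖g x‖ ≤ 1) :
    Tendsto (fun n => ∫ x, g x * p n x ∂ν) atTop (𝓝 (∫ x, g x * q x ∂ν)) := by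
  -- The positive part of q - p_n is dominated by q, so dominated convergence applies. Equal total
  -- masses then control the L¹ distance, since |p - q| = 2 (q - p)⁺ - (q - p).
  have hpos : Tendsto (fun n => ∫ x, max (q x - p n x) 0 ∂ν) atTop (𝓝 0) := by
    have h0 : (∫ _, (0 : ℝ) ∂ν) = 0 := by simp
    rw [show 𝓝 (0 : ℝ) = 𝓝 (∫ _, (0 : ℝ) ∂ν) by rw [h0]]
    refine tendsto_integral_filter_of_dominated_convergence q ?_ ?_ hq ?_
    · filter_upwards [hp] with n hn
      exact (hq.sub hn.1).pos_part.aestronglyMeasurable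
    · filter_upwards [hp] with n hn
      refine Eventually.of_forall fun x => ?_
      rw [Real.norm_of_nonneg (le_max_right _ _)]
      exact max_le (by linarith [hn.2.1 x]) (hq0 x)
    · refine Eventually.of_forall fun x => ?_
      have := ((tendsto_const_nhds (x := q x)).sub (hlim x)).max (tendsto_const_nhds (x := (0 : ℝ)))
      simpa using this
  rw [tendsto_iff_norm_sub_tendsto_zero]
  refine squeeze_zero' (Eventually.of_forall fun _ => norm_nonneg _) ?_
    (by simpa using hpos.const_mul 2)
  filter_upwards [hp] with n hn
  have i1 : Integrable (fun x => g x * (p n x : ℂ)) ν :=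
    Integrable.bdd_mul (c := 1) hn.1.ofReal hg (Eventually.of_forall hg1)
  have i2 : Integrable (fun x => g x * (q x : ℂ)) ν :=
    Integrable.bdd_mul (c := 1) hq.ofReal hg (Eventually.of_forall hg1)
  rw [← integral_sub i1 i2]
  have i3 : Integrable (fun x => max (q x - p n x) 0) ν := (hq.sub hn.1).pos_part
  have i4 : Integrable (fun x => q x - p n x) ν := hq.sub hn.1
  calc ‖∫ x, g x * (p n x : ℂ) - g x * (q x : ℂ) ∂ν‖
      ≤ ∫ x, 2 * max (q x - p n x) 0 - (q x - p n x) ∂ν := by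
        refine norm_integral_le_of_norm_le ((i3.const_mul 2).sub i4)
          (Eventually.of_forall fun x => ?_)
        rw [← mul_sub, norm_mul, ← Complex.ofReal_sub, Complex.norm_real, Real.norm_eq_abs]
        calc ‖g x‖ * |p n x - q x| ≤ 1 * |p n x - q x| := by gcongr; exact hg1 x
          _ = 2 * max (q x - p n x) 0 - (q x - p n x) := by
            rw [one_mul]
            rcases le_total (q x) (p n x) with h | h
            · rw [max_eq_right (by linarith), abs_of_nonneg (by linarith)]; ring
            · rw [max_eq_left (by linarith), abs_of_nonpos (by linarith)]; ring
    _ = 2 * ∫ x, max (q x - p n x) 0 ∂ν := by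
        rw [integral_sub (i3.const_mul 2) i4, integral_sub hq hn.1, hn.2.2, sub_self, sub_zero,
          integral_const_mul]

/-- Convergence of Stieltjes transforms on one horizontal line implies weak convergence. -/
theorem tendsto_of_tendsto_stieltjes {μ : ℕ → ProbabilityMeasure ℝ} {μ₀ : ProbabilityMeasure ℝ}
    {η : ℝ} (hη : 0 < η)
    (h : ∀ x : ℝ, Tendsto (fun n => ∫ u : ℝ, ((u : ℂ) - (x + η * Complex.I))⁻¹ ∂(μ n : Measure ℝ))
      atTop (𝓝 (∫ u : ℝ, ((u : ℂ) - (x + η * Complex.I))⁻¹ ∂(μ₀ : Measure ℝ)))) :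
    Tendsto μ atTop (𝓝 μ₀) := by
  refine ProbabilityMeasure.tendsto_of_tendsto_charFun fun t => ?_
  have hd : ∀ x, Tendsto (fun n => cauchySmoothing (μ n : Measure ℝ) η x) atTop
      (𝓝 (cauchySmoothing (μ₀ : Measure ℝ) η x)) := by
    intro x
    simp only [cauchySmoothing_eq hη]
    exact ((Complex.continuous_im.tendsto _).comp (h x)).const_mul _
  have hs := tendsto_integral_mul_of_tendsto_density
    (p := fun n => cauchySmoothing (μ n : Measure ℝ) η) (q := cauchySmoothing (μ₀ : Measure ℝ) η)
    (Eventually.of_forall fun n => ⟨integrable_cauchySmoothing hη, cauchySmoothing_nonneg hη, by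
      rw [integral_cauchySmoothing hη, integral_cauchySmoothing hη]⟩)
    (integrable_cauchySmoothing hη) (cauchySmoothing_nonneg hη) hd
    (g := fun x : ℝ => Complex.exp (t * x * Complex.I))
    (Continuous.aestronglyMeasurable (by fun_prop))
    (fun x => by rw [← Complex.ofReal_mul, Complex.norm_exp_ofReal_mul_I])
  simp only [integral_exp_mul_cauchySmoothing hη] at hs
  have hne := integral_exp_mul_cauchy_ne_zero hη t
  have := hs.div_const (∫ x : ℝ, Complex.exp (t * x * Complex.I)
          * ((Real.pi⁻¹ * η * (x ^ 2 + η ^ 2)⁻¹ : ℝ) : ℂ))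
  simpa only [mul_div_cancel_right₀ _ hne] using this

/-- **Pólya's theorem**: pointwise convergence of distribution functions to a continuous
distribution function is uniform. -/
theorem eventually_abs_sub_le_of_tendsto {F : ℕ → ℝ → ℝ} {G : ℝ → ℝ} (hF : ∀ n, Monotone (F n))
    (hF0 : ∀ n x, 0 ≤ F n x) (hF1 : ∀ n x, F n x ≤ 1) (hG : Monotone G) (hGc : Continuous G)
    (hbot : Tendsto G atBot (𝓝 0)) (htop : Tendsto G atTop (𝓝 1))
    (hlim : ∀ x, Tendsto (fun n => F n x) atTop (𝓝 (G x))) {ε : ℝ} (hε : 0 < ε) :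
    ∀ᶠ n in atTop, ∀ x, |F n x - G x| ≤ ε := by
  have hnear : ∀ x, ∀ᶠ n in atTop, |F n x - G x| < ε / 3 := fun x => by
    have := (Metric.tendsto_nhds.mp (hlim x)) (ε / 3) (by positivity)
    simpa [Real.dist_eq] using this
  have hG0 : ∀ x, 0 ≤ G x := fun x => hG.le_of_tendsto hbot x
  have hG1 : ∀ x, G x ≤ 1 := fun x => hG.ge_of_tendsto htop x
  obtain ⟨a, ha⟩ := (hbot.eventually_lt_const (show (0 : ℝ) < ε / 3 by positivity)).exists
  obtain ⟨b, hb⟩ := (htop.eventually_const_lt (show 1 - ε / 3 < (1 : ℝ) by linarith)).exists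
  have hcomp : ∀ᶠ n in atTop, ∀ x ∈ Set.Icc a b, |F n x - G x| ≤ ε := by
    refine isCompact_Icc.induction_on (p := fun s => ∀ᶠ n in atTop, ∀ x ∈ s, |F n x - G x| ≤ ε)
      (Eventually.of_forall fun n x hx => hx.elim) (fun s t hst h => ?_) (fun s t hs ht => ?_)
      (fun x _ => ?_)
    · filter_upwards [h] with n hn x hx using hn x (hst hx)
    · filter_upwards [hs, ht] with n h1 h2 x hx using hx.elim (h1 x) (h2 x)
    · obtain ⟨r, hr, hrG⟩ := Metric.continuous_iff.mp hGc x (ε / 3) (by positivity)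
      refine ⟨Set.Icc (x - r / 2) (x + r / 2),
        mem_nhdsWithin_of_mem_nhds (Icc_mem_nhds (by linarith) (by linarith)), ?_⟩
      have h1 := hrG (x - r / 2) (by
        rw [Real.dist_eq, show x - r / 2 - x = -(r / 2) by ring, abs_neg,
          abs_of_pos (by positivity)]
        linarith)
      have h2 := hrG (x + r / 2) (by
        rw [Real.dist_eq, add_sub_cancel_left, abs_of_pos (by positivity)]; linarith)
      rw [Real.dist_eq, abs_lt] at h1 h2
      filter_upwards [hnear (x - r / 2), hnear (x + r / 2)] with n k1 k2 y hy
      rw [abs_lt] at k1 k2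
      have m1 := hF n hy.1
      have m2 := hF n hy.2
      have m3 := hG hy.1
      have m4 := hG hy.2
      rw [abs_le]
      constructor <;> linarith
  filter_upwards [hcomp, hnear a, hnear b] with n hn ka kb x
  rw [abs_lt] at ka kb
  rcases lt_or_ge x a with hxa | hxa
  · have h1 := hF n hxa.le
    have h2 := hG hxa.le
    have h3 := hF0 n x
    have h4 := hG0 x
    rw [abs_le]
    constructor <;> linarith
  · rcases lt_or_ge b x with hxb | hxb
    · have h1 := hF n hxb.le
      have h2 := hG hxb.le
      have h3 := hF1 n x
      have h4 := hG1 x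
      rw [abs_le]
      constructor <;> linarith
    · exact hn x ⟨hxa, hxb⟩

/-! ### The quantitative bound for n^{-1/2} Y in terms of the Lindeberg ratio. -/

section GaussianMatrix

variable {Ω : Type*} [MeasurableSpace Ω] {P : Measure Ω} [IsProbabilityMeasure P]

/-- The second moment is split at the level τ√n, and the large part of one entry is bounded by that
of its whole row. The right side does not depend on j, so it bounds the largest variance of the row,
and its row average is governed by the Lindeberg ratio. -/
theorem sq_le_add_sum_indicator {n : ℕ} {Y : Ω → Matrix (Fin n) (Fin n) ℝ} {σ : Fin n → Fin n → ℝ}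
    (hgauss : ∀ i j, HasLaw (fun ω => Y ω i j) (gaussianReal 0 (σ i j ^ 2).toNNReal) P)
    (τ : ℝ) (i j : Fin n) :
    σ i j ^ 2 ≤ τ ^ 2 * n + ∑ k, ∫ ω, Set.indicator {ω' | τ * Real.sqrt n ≤ |Y ω' i k|}
      (fun ω' => |Y ω' i k| ^ 2) ω ∂P := by
  have hsq := (integral_comp_of_hasLaw_gaussian (hgauss i j)).2.1
  rw [Real.coe_toNNReal _ (sq_nonneg _)] at hsq
  have hint : Integrable (fun ω => |Y ω i j| ^ 2) P := by
    simp only [sq_abs]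
    exact (memLp_of_hasLaw_gaussian (hgauss i j) 2).integrable_sq
  have hset : NullMeasurableSet {ω' | τ * Real.sqrt n ≤ |Y ω' i j|} P :=
    nullMeasurableSet_le aemeasurable_const
      (continuous_abs.measurable.comp_aemeasurable (hgauss i j).aemeasurable)
  have hind : Integrable (Set.indicator {ω' | τ * Real.sqrt n ≤ |Y ω' i j|}
      (fun ω' => |Y ω' i j| ^ 2)) P := hint.indicator₀ hset
  have hle : σ i j ^ 2 ≤ τ ^ 2 * n + ∫ ω, Set.indicator {ω' | τ * Real.sqrt n ≤ |Y ω' i j|}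
      (fun ω' => |Y ω' i j| ^ 2) ω ∂P := by
    rw [← hsq]
    calc ∫ ω, Y ω i j ^ 2 ∂P
        ≤ ∫ ω, (τ ^ 2 * n + Set.indicator {ω' | τ * Real.sqrt n ≤ |Y ω' i j|}
            (fun ω' => |Y ω' i j| ^ 2) ω) ∂P := by
          refine integral_mono (by simpa only [sq_abs] using hint)
            ((integrable_const _).add hind) fun ω => ?_
          simp only [Set.indicator_apply, Set.mem_ofPred_eq]
          split_ifs with h
          · rw [sq_abs]
            have : 0 ≤ τ ^ 2 * (n : ℝ) := by positivity
            linarith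
          · push Not at h
            have := pow_le_pow_left₀ (abs_nonneg _) h.le 2
            rw [mul_pow, Real.sq_sqrt (Nat.cast_nonneg n), sq_abs] at this
            linarith
      _ = _ := by rw [integral_add (integrable_const _) hind]; simp
  refine hle.trans (add_le_add le_rfl ?_)
  exact Finset.single_le_sum (f := fun k => ∫ ω, Set.indicator {ω' | τ * Real.sqrt n ≤ |Y ω' i k|}
      (fun ω' => |Y ω' i k| ^ 2) ω ∂P)
    (fun k _ => integral_nonneg fun ω => Set.indicator_nonneg (fun _ _ => by positivity) _)
    (Finset.mem_univ j)

theorem norm_stieltjes_meanSpectralMeasure_sub_le {n : ℕ} (hn : n ≠ 0)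
    {Y : Ω → Matrix (Fin n) (Fin n) ℝ} {σ : Fin n → Fin n → ℝ} (hsymm : ∀ ω, (Y ω).IsSymm)
    (hindep : iIndepFun
      (fun (p : {p : Fin n × Fin n // p.1 ≤ p.2}) (ω : Ω) => Y ω p.1.1 p.1.2) P)
    (hgauss : ∀ i j, HasLaw (fun ω => Y ω i j) (gaussianReal 0 (σ i j ^ 2).toNNReal) P)
    {C : ℝ} (hmax : ∀ i, rowB σ i ≤ C) {z m : ℂ} (hz : 0 < z.im) (hm : m * (-z - m) = 1)
    (hmb : ‖m‖ ≤ 1 / z.im) (hC : C ^ 2 ≤ z.im ^ 2 / 2) (τ : ℝ) {δ : ℝ} (hδ : 0 < δ) :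
    ‖∫ u : ℝ, ((u : ℂ) - z)⁻¹ ∂meanSpectralMeasure P
        (fun ω => isHermitian_normalized (hsymm ω)) - m‖
      ≤ (2 / z.im ^ 2) * (2 * δ + (τ ^ 2 + lindebergRatio P Y τ)
          * (1 / δ + 2 * C ^ 2 / (z.im ^ 2 * δ) + 1 / z.im)
        + (1 / (n : ℝ) * ∑ i, |rowB σ i ^ 2 - 1|) / z.im) := by
  have hn0 : (0 : ℝ) < n := by exact_mod_cast Nat.pos_of_ne_zero hn
  set c : ℝ := (Real.sqrt n)⁻¹ with hc
  have hc2 : c ^ 2 = 1 / n := by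
    rw [hc, inv_pow, Real.sq_sqrt hn0.le, one_div]
  set X : Ω → Matrix (Fin n) (Fin n) ℝ := fun ω => c • Y ω with hX
  have hXs : ∀ ω, (X ω).IsSymm := fun ω => by
    simp only [hX, Matrix.IsSymm, Matrix.transpose_smul, (hsymm ω).eq]
  have hXH : ∀ ω, (X ω).IsHermitian := fun ω => isHermitian_normalized (hsymm ω)
  set s : Fin n → Fin n → ℝ≥0 := fun i j => ⟨c ^ 2, sq_nonneg _⟩ * (σ i j ^ 2).toNNReal with hs
  have hsv : ∀ i j, (s i j : ℝ) = 1 / n * σ i j ^ 2 := by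
    intro i j
    change c ^ 2 * ((σ i j ^ 2).toNNReal : ℝ) = _
    rw [Real.coe_toNNReal _ (sq_nonneg _), hc2]
  have hlaw : ∀ i j, HasLaw (fun ω => X ω i j) (gaussianReal 0 (s i j)) P := by
    intro i j
    have := gaussianReal_const_mul (hgauss i j) c
    rw [mul_zero] at this
    exact this
  have hXi : iIndepFun
      (fun (p : {p : Fin n × Fin n // p.1 ≤ p.2}) (ω : Ω) => X ω p.1.1 p.1.2) P :=
    hindep.comp (fun _ y => c * y) (fun _ => by fun_prop)
  have hme : ∀ i j, AEMeasurable (fun ω => X ω i j) P := fun i j => (hlaw i j).aemeasurable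
  have hrow : ∀ i, ∑ j, (s i j : ℝ) = rowB σ i ^ 2 := by
    intro i
    rw [rowB, Real.sq_sqrt (mul_nonneg (by positivity)
      (Finset.sum_nonneg fun j _ => sq_nonneg _)), Finset.mul_sum]
    exact Finset.sum_congr rfl fun j _ => hsv i j
  -- A bound on the variances of row i after normalisation, chosen so that its average over i is
  -- exactly τ² plus the Lindeberg ratio.
  set M : Fin n → ℝ := fun i => τ ^ 2 + 1 / n * ∑ k, ∫ ω,
    Set.indicator {ω' | τ * Real.sqrt n ≤ |Y ω' i k|} (fun ω' => |Y ω' i k| ^ 2) ω ∂P with hM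
  have hsM : ∀ i j, (s i j : ℝ) ≤ M i := by
    intro i j
    have h := mul_le_mul_of_nonneg_left (sq_le_add_sum_indicator hgauss τ i j)
      (show (0 : ℝ) ≤ 1 / n by positivity)
    rw [hsv, hM]
    refine h.trans (le_of_eq ?_)
    field_simp
  have hsum := sum_integral_norm_matrixResolvent_sub_le hXs hXi hlaw hz hm hmb hδ hsM
    (V := C ^ 2) (fun i => by
      rw [hrow]
      exact pow_le_pow_left₀ (Real.sqrt_nonneg _) (hmax i) 2) hC
  simp only [hrow, Fintype.card_fin] at hsum
  have hMsum : ∑ i, M i = n * (τ ^ 2 + lindebergRatio P Y τ) := by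
    simp only [hM, Finset.sum_add_distrib, Finset.sum_const, Finset.card_univ, Fintype.card_fin,
      nsmul_eq_mul, ← Finset.mul_sum, lindebergRatio]
    field_simp
  have iG : ∀ i, Integrable (fun ω => matrixResolvent (X ω) z i i) P := fun i =>
    Integrable.of_bound (aemeasurable_matrixResolvent hme z i i).aestronglyMeasurable
      (1 / z.im) (Eventually.of_forall fun ω => norm_matrixResolvent_diag_le (hXH ω) hz i)
  have hst : ∫ u : ℝ, ((u : ℂ) - z)⁻¹ ∂meanSpectralMeasure P
        (fun ω => isHermitian_normalized (hsymm ω)) - m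
      = (n : ℝ)⁻¹ • ∑ i, ∫ ω, (matrixResolvent (X ω) z i i - m) ∂P := by
    rw [integral_meanSpectralMeasure hme (fun ω => isHermitian_normalized (hsymm ω))
      (continuous_inv_ofReal_sub hz).stronglyMeasurable (norm_inv_ofReal_sub_le hz)]
    have e1 : ∀ ω, ∑ i, (((isHermitian_normalized (hsymm ω)).eigenvalues i : ℂ) - z)⁻¹
        = ∑ i, matrixResolvent (X ω) z i i := fun ω => (trace_matrixResolvent (hXH ω) hz.ne').symm
    simp only [e1]
    rw [integral_finsetSum _ fun i _ => iG i]
    have e2 : ∀ i, ∫ ω, (matrixResolvent (X ω) z i i - m) ∂P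
        = ∫ ω, matrixResolvent (X ω) z i i ∂P - m := fun i => by
      rw [integral_sub (iG i) (integrable_const _)]; simp
    simp only [e2, Finset.sum_sub_distrib, Finset.sum_const, Finset.card_univ, Fintype.card_fin,
      nsmul_eq_mul, smul_sub]
    congr 1
    rw [Complex.real_smul]
    have : (n : ℂ) ≠ 0 := by exact_mod_cast hn
    push_cast
    field_simp
  rw [hst, norm_smul, norm_inv, Real.norm_of_nonneg hn0.le]
  have hb : ‖∑ i, ∫ ω, (matrixResolvent (X ω) z i i - m) ∂P‖
      ≤ ∑ i, ∫ ω, ‖matrixResolvent (X ω) z i i - m‖ ∂P :=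
    norm_sum_le_of_le _ fun i _ => norm_integral_le_integral_norm _
  rw [hMsum] at hsum
  rw [inv_mul_le_iff₀ hn0]
  refine (hb.trans hsum).trans (le_of_eq ?_)
  field_simp

end GaussianMatrix

/-- The order of choices matters: δ first, then τ depending on the factor K, which blows up as δ
tends to 0, and n last. In the limit δ contributes ε/2 and τ contributes ε/4. -/
theorem tendsto_stieltjes_bound {L : ℝ → ℕ → ℝ} {η C : ℝ} (hη : 0 < η)
    (hL : ∀ τ, 0 < τ → Tendsto (L τ) atTop (𝓝 0)) {ρ : ℕ → ℝ} (hρ : Tendsto ρ atTop (𝓝 0))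
    {a : ℕ → ℝ} (ha0 : ∀ n, 0 ≤ a n)
    (ha : ∀ τ δ : ℝ, 0 < τ → 0 < δ → ∀ᶠ n in atTop, a n ≤ (2 / η ^ 2) * (2 * δ + (τ ^ 2 + L τ n)
      * (1 / δ + 2 * C ^ 2 / (η ^ 2 * δ) + 1 / η) + ρ n / η)) :
    Tendsto a atTop (𝓝 0) := by
  rw [Metric.tendsto_nhds]
  intro ε hε
  set δ : ℝ := ε * η ^ 2 / 8 with hδ
  have hδ0 : 0 < δ := by positivity
  set K : ℝ := 1 / δ + 2 * C ^ 2 / (η ^ 2 * δ) + 1 / η with hK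
  have hK0 : 0 < K := by positivity
  set τ : ℝ := Real.sqrt (ε * η ^ 2 / (8 * K)) with hτ
  have hτ0 : 0 < τ := Real.sqrt_pos.mpr (by positivity)
  have hτ2 : τ ^ 2 = ε * η ^ 2 / (8 * K) := Real.sq_sqrt (by positivity)
  have hlim : Tendsto (fun n => (2 / η ^ 2) * (2 * δ + (τ ^ 2 + L τ n) * K + ρ n / η)) atTop
      (𝓝 ((2 / η ^ 2) * (2 * δ + (τ ^ 2 + 0) * K + 0 / η))) :=
    (((((hL τ hτ0).const_add (τ ^ 2)).mul_const K).const_add (2 * δ)).add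
      (hρ.div_const η)).const_mul _
  have hval : (2 / η ^ 2) * (2 * δ + (τ ^ 2 + 0) * K + 0 / η) < ε := by
    have : (2 / η ^ 2) * (2 * δ + (τ ^ 2 + 0) * K + 0 / η) = 3 / 4 * ε := by
      rw [hτ2, hδ]
      field_simp
      ring
    rw [this]; linarith
  filter_upwards [ha τ δ hτ0 hδ0, hlim.eventually_lt_const hval] with n h1 h2
  rw [Real.dist_eq, sub_zero, abs_of_nonneg (ha0 n)]
  exact h1.trans_lt h2

end SemicircleLaw

/-! ### Assembly of the semicircle law. -/

theorem theorem4 {Ω : Type*} [MeasurableSpace Ω] (P : Measure Ω) [IsProbabilityMeasure P]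
    (Y : (n : ℕ) → Ω → Matrix (Fin n) (Fin n) ℝ)
    (σ : (n : ℕ) → Fin n → Fin n → ℝ)
    (hsymm : ∀ n ω, (Y n ω).IsSymm)
    (hindep : ∀ n, iIndepFun
      (fun (p : {p : Fin n × Fin n // p.1 ≤ p.2}) (ω : Ω) => Y n ω p.1.1 p.1.2) P)
    (hgauss : ∀ n i j,
      HasLaw (fun ω => Y n ω i j) (gaussianReal 0 (σ n i j ^ 2).toNNReal) P)
    (hlindeberg : ∀ τ : ℝ, 0 < τ →
      Tendsto (fun n => SemicircleLaw.lindebergRatio P (Y n) τ) atTop (𝓝 0))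
    (hrow : Tendsto
      (fun n : ℕ => 1 / (n : ℝ) * ∑ i, |SemicircleLaw.rowB (σ n) i ^ 2 - 1|) atTop (𝓝 0))
    (C : ℝ) (hmax : ∀ n i, SemicircleLaw.rowB (σ n) i ≤ C) :
    Tendsto
      (fun n => ⨆ x : ℝ, ENNReal.ofReal
        |SemicircleLaw.expectedSpectralCDF P (hsymm n) x - SemicircleLaw.semicircleCDF x|)
      atTop (𝓝 0) := by
  have hme : ∀ (n : ℕ) i j, AEMeasurable (fun ω => ((Real.sqrt n)⁻¹ • Y n ω) i j) P := fun n i j =>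
    (hgauss n i j).aemeasurable.const_mul _
  let hH := fun n ω => SemicircleLaw.isHermitian_normalized (hsymm n ω)
  -- The index is shifted by one because the mean spectral measure of an empty matrix is not a
  -- probability measure.
  let μ : ℕ → ProbabilityMeasure ℝ := fun n =>
    ⟨SemicircleLaw.meanSpectralMeasure P (hH (n + 1)),
      SemicircleLaw.isProbabilityMeasure_meanSpectralMeasure n.succ_ne_zero (hme (n + 1))
        (hH (n + 1))⟩
  let μ₀ : ProbabilityMeasure ℝ := ⟨SemicircleLaw.semicircleMeasure, inferInstance⟩
  -- The height of the line, large enough that C² ≤ η²/2 and the self-consistent term can be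
  -- absorbed.
  set η : ℝ := 2 * (|C| + 1) with hη
  have hη0 : 0 < η := by positivity
  have hCη : C ^ 2 ≤ η ^ 2 / 2 := by
    rw [hη, ← sq_abs C]
    nlinarith [abs_nonneg C]
  have hweak : Tendsto μ atTop (𝓝 μ₀) := by
    refine SemicircleLaw.tendsto_of_tendsto_stieltjes hη0 fun x => ?_
    have hzim : ((x : ℂ) + η * Complex.I).im = η := by simp
    have hz : 0 < ((x : ℂ) + η * Complex.I).im := by rw [hzim]; exact hη0
    obtain ⟨hm, hmb⟩ := SemicircleLaw.stieltjes_semicircleMeasure hz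
    rw [tendsto_iff_norm_sub_tendsto_zero]
    refine SemicircleLaw.tendsto_stieltjes_bound (η := η) (C := C) hη0
      (L := fun τ n => SemicircleLaw.lindebergRatio P (Y (n + 1)) τ)
      (fun τ hτ => (hlindeberg τ hτ).comp (tendsto_add_atTop_nat 1))
      (hrow.comp (tendsto_add_atTop_nat 1)) (fun _ => norm_nonneg _)
      fun τ δ _ hδ => Eventually.of_forall fun n => ?_
    have := SemicircleLaw.norm_stieltjes_meanSpectralMeasure_sub_le n.succ_ne_zero (hsymm (n + 1))
      (hindep (n + 1)) (hgauss (n + 1)) (hmax (n + 1)) hz hm hmb (by rwa [hzim]) τ hδ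
    rw [hzim] at this
    exact this
  have hcdf : ∀ n x, SemicircleLaw.expectedSpectralCDF P (hsymm (n + 1)) x
      = (μ n : Measure ℝ).real (Set.Iic x) := fun n x =>
    (SemicircleLaw.meanSpectralMeasure_real_Iic (hme (n + 1)) (hH (n + 1)) x).symm
  have hcdf₀ : SemicircleLaw.semicircleCDF = cdf (μ₀ : Measure ℝ) := by
    funext x
    rw [SemicircleLaw.semicircleCDF_eq, cdf_eq_real]
    rfl
  have hpt : ∀ x, Tendsto (fun n => (μ n : Measure ℝ).real (Set.Iic x)) atTop
      (𝓝 (cdf (μ₀ : Measure ℝ) x)) := by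
    intro x
    -- Portmanteau: the boundary of the half-line is a single point, which the semicircle law does
    -- not charge. The same absence of atoms gives continuity of the limit below.
    have h := ProbabilityMeasure.tendsto_measure_of_null_frontier_of_tendsto' hweak
      (E := Set.Iic x) (by
        rw [frontier_Iic]
        exact SemicircleLaw.semicircleMeasure_singleton x)
    rw [cdf_eq_real]
    exact (ENNReal.tendsto_toReal (measure_ne_top _ _)).comp h
  have hcont : Continuous (cdf (μ₀ : Measure ℝ)) := by
    rw [continuous_iff_continuousAt]
    intro x
    have h1 := (cdf (μ₀ : Measure ℝ)).measure_singleton x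
    rw [measure_cdf] at h1
    have h2 : (μ₀ : Measure ℝ) {x} = 0 := SemicircleLaw.semicircleMeasure_singleton x
    rw [h2, eq_comm, ENNReal.ofReal_eq_zero, sub_nonpos] at h1
    rw [(monotone_cdf _).continuousAt_iff_leftLim_eq_rightLim, StieltjesFunction.rightLim_eq]
    exact le_antisymm ((monotone_cdf _).leftLim_le le_rfl) h1
  rw [← tendsto_add_atTop_iff_nat 1, ENNReal.tendsto_atTop_zero]
  intro ε hε
  obtain ⟨r, hr0, hr⟩ := ENNReal.lt_iff_exists_nnreal_btwn.mp hε
  have hunif := SemicircleLaw.eventually_abs_sub_le_of_tendsto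
    (F := fun n x => (μ n : Measure ℝ).real (Set.Iic x)) (G := cdf (μ₀ : Measure ℝ))
    (fun n x y hxy => measureReal_mono (Set.Iic_subset_Iic.mpr hxy))
    (fun n x => measureReal_nonneg) (fun n x => measureReal_le_one) (monotone_cdf _) hcont
    (tendsto_cdf_atBot _) (tendsto_cdf_atTop _) hpt (ε := r) (by exact_mod_cast hr0)
  obtain ⟨N, hN⟩ := eventually_atTop.mp hunif
  refine ⟨N, fun n hn => iSup_le fun x => ?_⟩
  rw [hcdf, hcdf₀]
  refine le_trans ?_ hr.le
  rw [← ENNReal.ofReal_coe_nnreal]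
  exact ENNReal.ofReal_le_ofReal (hN n hn x)
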